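/- Consider a two-tier cellular network in $\mathbb{R}^2$ with a typical user at the origin. Let $\lambda_1,\lambda_2,D>0$, $0<\theta_c\le 2\pi$, and put $\lambda_{PHP}=\lambda_2\exp(-\lambda_1\theta_cD^2/2)$, the equivalent density of the Poisson hole process obtained from a Poisson process of density $\lambda_2$ by removing the points in circular sectors of radius $D$ and central angle $\theta_c$ attached to the points of an independent Poisson process of density $\lambda_1$. The tier-1 base stations (BSs) form a homogeneous Poisson process of density $\lambda_1$; the Poisson hole process of tier-2 BSs is approximated by a homogeneous Poisson process of density $\lambda_{PHP}$ that is independent of tier 1. Given all BS locations, the links from the BSs to the user are independently LOS or NLOS: a link of length $r$ is LOS with probability $P^{LOS}(r)$ and NLOS with probability $P^{NLOS}(r)=1-P^{LOS}(r)$, where $P^{LOS}:[0,\infty)\to[0,1]$ is non-increasing. A tier-$k$ BS at distance $r$ whose link is in state $s\in\{LOS,NLOS\}$ has average received power $P_kM_kM_{UE}\,r^{-\alpha^s}$, with transmit power $P_k>0$, main-lobe gains $M_k,M_{UE}>0$ of the BS and the user, and path loss exponents $\alpha^s>0$. The user is associated with a BS of tier $k$ in state $s$ if such a BS has strictly larger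 average received power than every other BS of the network. Put $$\Lambda^s_{1,PHP}([0,r))=2\pi\lambda_1\int_0^r xP^s(x)\,dx,\qquad \Lambda^s_{2,PHP}([0,r))=2\pi\lambda_{PHP}\int_0^r xP^s(x)\,dx,$$ and $\Lambda'^s_{k,PHP}([0,r))=\frac{d}{dr}\Lambda^s_{k,PHP}([0,r))$, which exists for almost every $r>0$. Then, for every $k\in\{1,2\}$ and $s\in\{LOS,NLOS\}$, the probability that the user is associated with a BS of tier $k$ in state $s$ is $$A_k^s=\int_0^\infty \Lambda'^s_{k,PHP}([0,x))\exp\Big(-\sum_{j=1}^2\sum_{s'\in\{LOS,NLOS\}}\Lambda^{s'}_{j,PHP}([0,R_j^{s'}(x)))\Big)dx,$$ where the integrand is integrable and $$R_j^{s'}(x)=\Big(\frac{P_j}{P_k}\cdot\frac{M_j}{M_k}\Big)^{1/\alpha^{s'}}x^{\alpha^s/\alpha^{s'}}.$$ -/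

import Mathlib

open MeasureTheory ProbabilityTheory

noncomputable section

namespace HCN

/-- The Euclidean plane in which base stations (BSs) and users live. -/
abbrev Plane : Type := EuclideanSpace ℝ (Fin 2)

/-- The two tiers: macro BSs (tier 1) and small BSs (tier 2). -/
inductive Tier : Type where
  | macroBS
  | smallBS
  deriving DecidableEq

/-- The state of the link between a BS and the typical user. -/
inductive LinkState : Type where
  | los
  | nlos
  deriving DecidableEq

instance : Fintype Tier := ⟨{.macroBS, .smallBS}, fun j => by cases j <;> simp⟩

instance : Fintype LinkState := ⟨{.los, .nlos}, fun s => by cases s <;> simp⟩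

instance : MeasurableSpace LinkState := ⊤

/-! ### Point processes -/

/-- The random counting measure `∑ i, δ_{X i}` of a sequence of random points: on a measurable
set it counts the indices whose point lies in the set. -/
def countingProcess {Ω E : Type*} [MeasurableSpace E] (X : ℕ → Ω → E) (ω : Ω) : Measure E :=
  Measure.sum fun i => Measure.dirac (X i ω)

/-- `N` is a Poisson point process with intensity measure `Λ`: the number of points in a
measurable set `B` with `Λ B < ∞` has the Poisson law of mean `Λ B`, and the numbers of points in
pairwise disjoint measurable sets are independent. -/
structure IsPoissonProcess {Ω E : Type*} [MeasurableSpace Ω] [MeasurableSpace E]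
    (N : Ω → Measure E) (Λ : Measure E) (μ : Measure Ω) : Prop where
  measurable : Measurable N
  hasLaw : ∀ B : Set E, MeasurableSet B → Λ B ≠ ⊤ →
    HasLaw (fun ω => N ω B)
      ((poissonMeasure (Λ B).toNNReal).map fun n : ℕ => (n : ENNReal)) μ
  indep : ∀ (n : ℕ) (B : Fin n → Set E), (∀ i, MeasurableSet (B i)) →
    Pairwise (Function.onFun Disjoint B) → iIndepFun (fun i ω => N ω (B i)) μ

/-! ### Parameters of the network -/

/-- Parameters of the two-tier network (all powers and gains on a linear scale). -/
structure Network where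
  /-- density of the Poisson process of macro BSs -/
  lam₁ : ℝ
  /-- density of the baseline Poisson process of small BSs -/
  lam₂ : ℝ
  /-- radius of the circular sectors that form the holes -/
  D : ℝ
  /-- central angle of the circular sectors that form the holes -/
  θc : ℝ
  /-- transmit power of the BSs of a tier -/
  P : Tier → ℝ
  /-- main lobe gain of the BSs of a tier -/
  M : Tier → ℝ
  /-- main lobe gain of the user -/
  MUE : ℝ
  /-- path loss exponents -/
  α : LinkState → ℝ
  /-- LOS probability of a link as a function of its length -/
  pLOS : ℝ → ℝ
  lam₁_pos : 0 < lam₁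
  lam₂_pos : 0 < lam₂
  D_pos : 0 < D
  θc_pos : 0 < θc
  θc_le : θc ≤ 2 * Real.pi
  P_pos : ∀ j, 0 < P j
  M_pos : ∀ j, 0 < M j
  MUE_pos : 0 < MUE
  α_pos : ∀ s, 0 < α s
  pLOS_nonneg : ∀ r, 0 ≤ r → 0 ≤ pLOS r
  pLOS_le_one : ∀ r, 0 ≤ r → pLOS r ≤ 1
  pLOS_antitone : AntitoneOn pLOS (Set.Ici 0)

namespace Network

variable (net : Network)

/-- The equivalent density `λ_PHP = λ₂ exp (-λ₁ θ_c D² / 2)` of the Poisson hole process. -/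
def lamPHP : ℝ := net.lam₂ * Real.exp (-(net.lam₁ * net.θc * net.D ^ 2 / 2))

/-- The density of the Poisson process of BSs of each tier, when the Poisson hole process of the
small BSs is approximated by a Poisson process of its equivalent density. -/
def density : Tier → ℝ
  | .macroBS => net.lam₁
  | .smallBS => net.lamPHP

/-- Probability that a link of length `r` is in a given state. -/
def stateProb : LinkState → ℝ → ℝ
  | .los, r => net.pLOS r
  | .nlos, r => 1 - net.pLOS r

/-- `Λ^s_{k,PHP}([0, r))`. -/
def Lam (k : Tier) (s : LinkState) (r : ℝ) : ℝ :=
  2 * Real.pi * net.density k * ∫ x in (0 : ℝ)..r, x * net.stateProb s x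

/-- The exclusion radius `R_j^{s'}(x)` when the user is served by a BS of tier `k` in state `s` at
distance `x`. -/
def exclusionRadius (k : Tier) (s : LinkState) (j : Tier) (s' : LinkState) (x : ℝ) : ℝ :=
  (net.P j / net.P k * (net.M j / net.M k)) ^ (1 / net.α s') * x ^ (net.α s / net.α s')

/-- Long-term averaged power received over a link of length `r` in state `s` from a BS of tier `k`
when both main lobes are aligned. -/
def avgPower (k : Tier) (s : LinkState) (r : ℝ) : ℝ :=
  net.P k * (net.M k * net.MUE) * r ^ (-net.α s)

/-! ### The random network seen by the typical user at the origin -/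

/-- `X j i` is the location of the `i`-th BS of tier `j` and `S j i` is the state of its link to the
typical user, who sits at the origin. The locations of the two tiers form independent homogeneous
Poisson processes; given all locations, the links are independently in the LOS or NLOS state, with
the probabilities prescribed by their lengths. -/
structure IsModel {Ω : Type*} [MeasurableSpace Ω] (X : Tier → ℕ → Ω → Plane)
    (S : Tier → ℕ → Ω → LinkState) (μ : Measure Ω) : Prop where
  measurable_location : ∀ j i, Measurable (X j i)
  measurable_state : ∀ j i, Measurable (S j i)
  poisson : ∀ j, IsPoissonProcess (countingProcess (X j))
    (ENNReal.ofReal (net.density j) • (volume : Measure Plane)) μ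
  indep_tiers : IndepFun (countingProcess (X .macroBS)) (countingProcess (X .smallBS)) μ
  condLaw_state : ∀ (F : Finset (Tier × ℕ)) (σ : Tier × ℕ → LinkState),
    μ⟦{ω | ∀ p ∈ F, S p.1 p.2 ω = σ p} |
        MeasurableSpace.comap (fun ω j i => X j i ω) MeasurableSpace.pi⟧
      =ᵐ[μ] fun ω => ∏ p ∈ F, net.stateProb (σ p) ‖X p.1 p.2 ω‖

/-- The event that the typical user is associated with a BS of tier `k` in state `s`: some such BS
provides a strictly larger averaged received power than every other BS of the network. -/
def associated {Ω : Type*} (X : Tier → ℕ → Ω → Plane) (S : Tier → ℕ → Ω → LinkState)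
    (k : Tier) (s : LinkState) : Set Ω :=
  {ω | ∃ i, S k i ω = s ∧ ∀ (j : Tier) (i' : ℕ), (j, i') ≠ (k, i) →
    net.avgPower j (S j i' ω) ‖X j i' ω‖ < net.avgPower k s ‖X k i ω‖}

end Network

end HCN

end

/-! Compare every BS with the class (k, s): a BS of class (j, s') at distance d is received like one
of class (k, s) at distance `equivDist` d, and the exclusion radius is the inverse map. Let τ₁ be
the distance to the nearest BS of class (k, s) and τ₂ the least equivalent distance over the other
classes. Outside a null set (equidistant points, a point at the origin, accumulation of points),
association with (k, s) means τ₁ < τ₂.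

The event a ≤ τ₁, b ≤ τ₂ says that no BS is closer than a radius fixed by its class. Given the
locations its probability is the product of `retainProb` over all BSs. Written as the exponential of
minus a sum over points, this product is averaged by the Laplace functional of each Poisson process;
independence of the tiers then gives exp(-∑ Λ) (`measure_forall_radii`). Only these void
probabilities are used: the thinned classes are never shown to be Poisson.

The exponent is a function of a plus a function of b, so τ₁ and τ₂ are independent. On [0, ∞) the
law of τ₁ has density Λ' exp(-Λ), with possibly an atom at ∞, and `measure_lt_of_survival`
integrates this density against P(τ₂ > x). Since R_k^s(x) = x, the two exponents merge into the
stated sum. The derivative Λ' exists almost everywhere because the monotone state probabilities have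
countably many discontinuities, and the integrand is integrable because its integral is a
probability. -/

noncomputable section
namespace HCN

/-! ### Exponentials on `[0, ∞]` and the Poisson generating function. -/

/-- The function `x ↦ exp (-x)` on `[0, ∞]`. -/
def expNeg (x : ENNReal) : ENNReal := EReal.exp (-(x : EReal))

lemma expNeg_zero : expNeg 0 = 1 := by simp [expNeg]

lemma continuous_expNeg : Continuous expNeg :=
  ENNReal.continuous_exp.comp (continuous_neg.comp continuous_coe_ennreal_ereal)

lemma measurable_expNeg : Measurable expNeg := continuous_expNeg.measurable

lemma antitone_expNeg : Antitone expNeg := fun _ _ h =>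
  EReal.exp_monotone (EReal.neg_le_neg_iff.2 (EReal.coe_ennreal_le_coe_ennreal_iff.2 h))

lemma expNeg_le_one (x : ENNReal) : expNeg x ≤ 1 := by
  simpa [expNeg_zero] using antitone_expNeg (zero_le (a := x))

lemma expNeg_add (x y : ENNReal) : expNeg (x + y) = expNeg x * expNeg y := by
  rw [expNeg, expNeg, expNeg, ← EReal.exp_add, EReal.coe_ennreal_add, EReal.neg_add, sub_eq_add_neg]
  · exact Or.inl (EReal.coe_ennreal_ne_bot x)
  · exact Or.inr (EReal.coe_ennreal_ne_bot y)

lemma expNeg_sum {ι : Type*} (t : Finset ι) (f : ι → ENNReal) :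
    expNeg (∑ i ∈ t, f i) = ∏ i ∈ t, expNeg (f i) := by
  classical
  induction t using Finset.induction_on with
  | empty => simp [expNeg_zero]
  | insert a t ha ih => rw [Finset.sum_insert ha, Finset.prod_insert ha, expNeg_add, ih]

lemma expNeg_nat_mul (n : ℕ) (x : ENNReal) : expNeg (n * x) = expNeg x ^ n := by
  have := expNeg_sum (Finset.range n) fun _ => x
  simpa using this

lemma expNeg_ofReal {r : ℝ} (hr : 0 ≤ r) :
    expNeg (ENNReal.ofReal r) = ENNReal.ofReal (Real.exp (-r)) := by
  rw [expNeg, EReal.coe_ennreal_ofReal, max_eq_left hr, ← EReal.coe_neg, EReal.exp_coe]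

lemma expNeg_neg_log {h : ENNReal} (hh : h ≤ 1) :
    expNeg (-(ENNReal.log h)).toENNReal = h := by
  rw [expNeg, EReal.coe_toENNReal, neg_neg, ENNReal.exp_log]
  simpa using hh

/-- The probability generating function, summed from the exponential series. -/
lemma lintegral_pow_poissonMeasure (m : NNReal) {q : ENNReal} (hq : q ≤ 1) :
    ∫⁻ n, q ^ n ∂(poissonMeasure m) = expNeg (m * (1 - q)) := by
  lift q to NNReal using ne_top_of_le_ne_top ENNReal.one_ne_top hq
  have hq' : (q : ℝ) ≤ 1 := by exact_mod_cast hq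
  have h1 : (m : ENNReal) * (1 - q) = ENNReal.ofReal (m * (1 - q)) := by
    rw [ENNReal.ofReal_mul (by positivity), ENNReal.ofReal_sub _ (by positivity)]
    simp
  have hs : HasSum (fun n : ℕ => Real.exp (-m) * ((m * q : ℝ) ^ n / n.factorial))
      (Real.exp (-m) * Real.exp (m * q)) := by
    have := NormedSpace.exp_series_hasSum_exp' (𝕂 := ℝ) (m * q : ℝ)
    rw [← Real.exp_eq_exp_ℝ] at this
    simpa [div_eq_inv_mul] using this.mul_left (Real.exp (-m))
  rw [h1, expNeg_ofReal (mul_nonneg m.coe_nonneg (sub_nonneg.2 hq')), poissonMeasure, lintegral_sum_measure]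
  simp only [lintegral_smul_measure, lintegral_dirac, smul_eq_mul]
  have : ∀ n : ℕ, ENNReal.ofReal (Real.exp (-m) * m ^ n / n.factorial) * (q : ENNReal) ^ n
      = ENNReal.ofReal (Real.exp (-m) * ((m * q : ℝ) ^ n / n.factorial)) := by
    intro n
    rw [← ENNReal.coe_pow, ← ENNReal.ofReal_coe_nnreal, ← ENNReal.ofReal_mul (by positivity)]
    congr 1
    push_cast
    rw [mul_pow]
    ring
  simp_rw [this]
  rw [← ENNReal.ofReal_tsum_of_nonneg (fun n => by positivity) hs.summable, hs.tsum_eq,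
    ← Real.exp_add]
  congr 2
  ring

/-! ### Laplace functional of a Poisson process. -/

section Laplace

variable {Ω E : Type*} [MeasurableSpace Ω] [MeasurableSpace E] {N : Ω → Measure E}
  {Λ : Measure E} {μ : Measure Ω}

lemma IsPoissonProcess.measurable_apply (h : IsPoissonProcess N Λ μ) {B : Set E}
    (hB : MeasurableSet B) : Measurable fun ω => N ω B :=
  (Measure.measurable_coe hB).comp h.measurable

/-- Since exp(-cn) = exp(-c)ⁿ, this is the generating function of the count at q = exp(-c). -/
lemma IsPoissonProcess.lintegral_expNeg_mul (h : IsPoissonProcess N Λ μ) {B : Set E}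
    (hB : MeasurableSet B) (hΛ : Λ B ≠ ⊤) (c : ENNReal) :
    ∫⁻ ω, expNeg (c * N ω B) ∂μ = expNeg ((1 - expNeg c) * Λ B) := by
  have hm : Measurable fun x : ENNReal => expNeg (c * x) :=
    measurable_expNeg.comp (measurable_const.mul measurable_id)
  rw [← lintegral_map (f := fun x => expNeg (c * x)) hm (h.measurable_apply hB),
    (h.hasLaw B hB hΛ).map_eq, lintegral_map hm (measurable_of_countable _)]
  simp_rw [mul_comm c, expNeg_nat_mul]
  rw [lintegral_pow_poissonMeasure _ (expNeg_le_one c), ENNReal.coe_toNNReal hΛ, mul_comm]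

/-- The level sets of `g` are disjoint, so their counts are independent and the expectation factors
over the values of `g`. -/
lemma IsPoissonProcess.lintegral_expNeg_simpleFunc (h : IsPoissonProcess N Λ μ)
    (g : SimpleFunc E ENNReal) (hg : ∀ c, c ≠ 0 → Λ (g ⁻¹' {c}) ≠ ⊤) :
    ∫⁻ ω, expNeg (∫⁻ x, g x ∂(N ω)) ∂μ = expNeg (∫⁻ x, (1 - expNeg (g x)) ∂Λ) := by
  classical
  have hsum : ∀ ω, ∫⁻ x, g x ∂(N ω) = ∑ c ∈ g.range, c * N ω (g ⁻¹' {c}) := fun ω => by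
    rw [← SimpleFunc.lintegral, SimpleFunc.lintegral_eq_lintegral]
  have hsum' : ∫⁻ x, (1 - expNeg (g x)) ∂Λ = ∑ c ∈ g.range, (1 - expNeg c) * Λ (g ⁻¹' {c}) := by
    rw [← SimpleFunc.map_lintegral, ← SimpleFunc.lintegral_eq_lintegral]
    rfl
  simp_rw [hsum, hsum', expNeg_sum]
  let e := g.range.equivFin
  have hind := h.indep g.range.card (fun i => g ⁻¹' {(e.symm i : ENNReal)})
    (fun i => g.measurableSet_preimage _) (fun i j hij => by
      refine Disjoint.preimage _ (Set.disjoint_singleton.2 fun hc => hij ?_)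
      exact e.symm.injective (Subtype.ext hc))
  have hind' := hind.comp (fun i x => expNeg ((e.symm i : ENNReal) * x))
    (fun i => measurable_expNeg.comp (measurable_const.mul measurable_id))
  have key := lintegral_prod_eq_prod_lintegral_of_indepFun Finset.univ _ hind'
    (fun i => (measurable_expNeg.comp (measurable_const.mul measurable_id)).comp
      (h.measurable_apply (g.measurableSet_preimage _)))
  have re : ∀ F : ENNReal → ENNReal, ∏ c ∈ g.range, F c = ∏ i, F (e.symm i) := fun F => by
    rw [← Finset.prod_coe_sort, ← e.symm.prod_comp]
  simp_rw [re]
  refine key.trans (Finset.prod_congr rfl fun i _ => ?_)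
  -- The level set of 0 may have infinite intensity, where no law is prescribed; both factors are
  -- then 1.
  by_cases hc : (e.symm i : ENNReal) = 0
  · have : IsProbabilityMeasure μ := hind.isProbabilityMeasure
    simp [hc, expNeg_zero]
  · exact h.lintegral_expNeg_mul (g.measurableSet_preimage _) (hg _ hc) _

/-- The Laplace functional of a Poisson process. -/
theorem IsPoissonProcess.lintegral_expNeg (h : IsPoissonProcess N Λ μ) [IsProbabilityMeasure μ]
    {g : E → ENNReal} (hg : Measurable g) (hΛ : Λ {x | g x ≠ 0} ≠ ⊤) :
    ∫⁻ ω, expNeg (∫⁻ x, g x ∂(N ω)) ∂μ = expNeg (∫⁻ x, (1 - expNeg (g x)) ∂Λ) := by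
  have hle : ∀ n x, SimpleFunc.eapprox g n x ≤ g x := fun n x => by
    rw [← SimpleFunc.iSup_eapprox_apply hg x]
    exact le_iSup (fun n => SimpleFunc.eapprox g n x) n
  have hmono : ∀ x, Monotone fun n => SimpleFunc.eapprox g n x := fun x n m hnm =>
    SimpleFunc.monotone_eapprox g hnm x
  have h1 : ∀ n, ∫⁻ ω, expNeg (∫⁻ x, SimpleFunc.eapprox g n x ∂(N ω)) ∂μ
      = expNeg (∫⁻ x, (1 - expNeg (SimpleFunc.eapprox g n x)) ∂Λ) := fun n => by
    refine h.lintegral_expNeg_simpleFunc _ fun c hc => ne_top_of_le_ne_top hΛ (measure_mono ?_)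
    rintro x (rfl : _ = c) h0
    exact hc (le_antisymm (h0 ▸ hle n x) bot_le)
  -- Monotone convergence handles the integral over the points and the exponent on the right; the
  -- bound `expNeg ≤ 1` dominates the outer integral.
  have h2 : ∀ ν : Measure E, Filter.Tendsto (fun n => ∫⁻ x, SimpleFunc.eapprox g n x ∂ν)
      Filter.atTop (nhds (∫⁻ x, g x ∂ν)) := fun ν =>
    lintegral_tendsto_of_tendsto_of_monotone
      (fun n => (SimpleFunc.eapprox g n).measurable.aemeasurable) (ae_of_all _ hmono)
      (ae_of_all _ fun x => SimpleFunc.tendsto_eapprox hg x)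
  have h3 : Filter.Tendsto (fun n => ∫⁻ x, (1 - expNeg (SimpleFunc.eapprox g n x)) ∂Λ)
      Filter.atTop (nhds (∫⁻ x, (1 - expNeg (g x)) ∂Λ)) := by
    refine lintegral_tendsto_of_tendsto_of_monotone
      (fun n => ((measurable_expNeg.comp (SimpleFunc.eapprox g n).measurable).const_sub 1).aemeasurable)
      (ae_of_all _ fun x n m hnm => tsub_le_tsub_left (antitone_expNeg (hmono x hnm)) _)
      (ae_of_all _ fun x => ?_)
    exact ENNReal.Tendsto.sub tendsto_const_nhds
      ((continuous_expNeg.tendsto _).comp (SimpleFunc.tendsto_eapprox hg x))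
      (Or.inl ENNReal.one_ne_top)
  have h4 : Filter.Tendsto (fun n => ∫⁻ ω, expNeg (∫⁻ x, SimpleFunc.eapprox g n x ∂(N ω)) ∂μ)
      Filter.atTop (nhds (∫⁻ ω, expNeg (∫⁻ x, g x ∂(N ω)) ∂μ)) := by
    refine tendsto_lintegral_of_dominated_convergence (fun _ => 1) (fun n => ?_)
      (fun n => ae_of_all _ fun ω => expNeg_le_one _) (by simp)
      (ae_of_all _ fun ω => (continuous_expNeg.tendsto _).comp (h2 _))
    exact measurable_expNeg.comp
      ((Measure.measurable_lintegral (SimpleFunc.eapprox g n).measurable).comp h.measurable)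
  refine tendsto_nhds_unique h4 ?_
  simp_rw [h1]
  exact (continuous_expNeg.tendsto _).comp h3

end Laplace

lemma sum_tier {M : Type*} [AddCommMonoid M] (f : Tier → M) :
    ∑ j, f j = f .macroBS + f .smallBS :=
  Finset.sum_pair (by simp)

lemma sum_linkState {M : Type*} [AddCommMonoid M] (f : LinkState → M) :
    ∑ s, f s = f .los + f .nlos :=
  Finset.sum_pair (by simp)

lemma lintegral_countingProcess {Ω E : Type*} [MeasurableSpace E] (Y : ℕ → Ω → E) {g : E → ENNReal}
    (hg : Measurable g) (ω : Ω) : ∫⁻ x, g x ∂(countingProcess Y ω) = ∑' i, g (Y i ω) := by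
  rw [countingProcess, lintegral_sum_measure]
  exact tsum_congr fun i => lintegral_dirac' _ hg

/-! ### State probabilities and the retention probability of a BS. -/

namespace Network

variable (net : Network)

lemma density_pos (j : Tier) : 0 < net.density j := by
  cases j
  · exact net.lam₁_pos
  · exact mul_pos net.lam₂_pos (Real.exp_pos _)

lemma stateProb_nonneg (s : LinkState) {r : ℝ} (hr : 0 ≤ r) : 0 ≤ net.stateProb s r := by
  cases s
  · exact net.pLOS_nonneg r hr
  · exact sub_nonneg.2 (net.pLOS_le_one r hr)

lemma stateProb_le_one (s : LinkState) {r : ℝ} (hr : 0 ≤ r) : net.stateProb s r ≤ 1 := by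
  cases s
  · exact net.pLOS_le_one r hr
  · exact sub_le_self _ (net.pLOS_nonneg r hr)

/-- The state probabilities, extended to negative lengths by their value at `0`. -/
def stateProbExt (s : LinkState) (r : ℝ) : ℝ := net.stateProb s (max r 0)

lemma stateProbExt_of_nonneg (s : LinkState) {r : ℝ} (hr : 0 ≤ r) :
    net.stateProbExt s r = net.stateProb s r := by
  rw [stateProbExt, max_eq_left hr]

lemma stateProbExt_nonneg (s : LinkState) (r : ℝ) : 0 ≤ net.stateProbExt s r :=
  net.stateProb_nonneg s (le_max_right _ _)

lemma stateProbExt_le_one (s : LinkState) (r : ℝ) : net.stateProbExt s r ≤ 1 :=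
  net.stateProb_le_one s (le_max_right _ _)

lemma antitone_stateProbExt_los : Antitone (net.stateProbExt .los) := fun _ _ h =>
  net.pLOS_antitone (Set.mem_Ici.2 (le_max_right _ _)) (Set.mem_Ici.2 (le_max_right _ _)) (max_le_max_right 0 h)

lemma monotone_stateProbExt_nlos : Monotone (net.stateProbExt .nlos) := fun _ _ h =>
  sub_le_sub_left (net.antitone_stateProbExt_los h) 1

/-- Measurability of the LOS probability is not assumed; it comes from monotonicity, which the
extension makes global. -/
lemma measurable_stateProbExt (s : LinkState) : Measurable (net.stateProbExt s) := by
  cases s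
  · exact net.antitone_stateProbExt_los.measurable
  · exact net.monotone_stateProbExt_nlos.measurable

lemma countable_not_continuousAt_stateProbExt (s : LinkState) :
    {r | ¬ContinuousAt (net.stateProbExt s) r}.Countable := by
  cases s
  · exact net.antitone_stateProbExt_los.countable_not_continuousAt
  · exact net.monotone_stateProbExt_nlos.countable_not_continuousAt

lemma measurable_stateProb_norm (s : LinkState) :
    Measurable fun x : Plane => net.stateProb s ‖x‖ := by
  have : (fun x : Plane => net.stateProb s ‖x‖) = fun x => net.stateProbExt s ‖x‖ := by
    funext x
    rw [net.stateProbExt_of_nonneg s (norm_nonneg x)]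
  rw [this]
  exact (net.measurable_stateProbExt s).comp measurable_norm

/-- Polar coordinates: the factor 2π is the dimension times the area of the unit disc. -/
lemma lintegral_stateProb_ball (j : Tier) (s : LinkState) {ρ : ℝ} (hρ : 0 ≤ ρ) :
    ∫⁻ x : Plane, (if ‖x‖ < ρ then ENNReal.ofReal (net.stateProb s ‖x‖) else 0)
      ∂(ENNReal.ofReal (net.density j) • volume) = ENNReal.ofReal (net.Lam j s ρ) := by
  set f : ℝ → ℝ := (Set.Iio ρ).indicator (net.stateProbExt s) with hf
  have hfm : Measurable f := (net.measurable_stateProbExt s).indicator measurableSet_Iio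
  have hf0 : ∀ r, 0 ≤ f r := fun r => Set.indicator_nonneg (fun _ _ => net.stateProbExt_nonneg s _) r
  have h1 : ∀ x : Plane, (if ‖x‖ < ρ then ENNReal.ofReal (net.stateProb s ‖x‖) else 0)
      = ENNReal.ofReal (f ‖x‖) := fun x => by
    by_cases h : ‖x‖ < ρ
    · simp [hf, h, net.stateProbExt_of_nonneg s (norm_nonneg x)]
    · simp [hf, h]
  have hint : Integrable (fun x : Plane => f ‖x‖) := by
    have hb : Integrable ((Metric.ball (0 : Plane) ρ).indicator fun _ => (1 : ℝ)) :=
      (integrable_indicator_iff measurableSet_ball).2 (integrableOn_const measure_ball_lt_top.ne)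
    refine hb.mono' (hfm.comp measurable_norm).aestronglyMeasurable (ae_of_all _ fun x => ?_)
    rw [Real.norm_of_nonneg (hf0 _)]
    by_cases h : ‖x‖ < ρ
    · simp [hf, h, net.stateProbExt_le_one]
    · simp [hf, h]
  have hball : (volume : Measure Plane).real (Metric.ball 0 1) = Real.pi := by
    rw [measureReal_def, EuclideanSpace.volume_ball_fin_two]
    simp [Real.pi_pos.le]
  simp_rw [h1]
  rw [lintegral_smul_measure, ← ofReal_integral_eq_lintegral_ofReal hint (ae_of_all _ fun x => hf0 _),
    smul_eq_mul, ← ENNReal.ofReal_mul (net.density_pos j).le, integral_fun_norm_addHaar, hball,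
    finrank_euclideanSpace_fin, Lam, intervalIntegral.integral_of_le hρ,
    integral_Ioc_eq_integral_Ioo]
  have h2 : ∫ y in Set.Ioi (0 : ℝ), y ^ (2 - 1) • f y = ∫ y in Set.Ioo 0 ρ, y * net.stateProb s y := by
    rw [← integral_indicator measurableSet_Ioi, ← integral_indicator measurableSet_Ioo]
    congr 1
    funext y
    by_cases h0 : 0 < y <;> by_cases h3 : y < ρ <;>
      simp [hf, h0, h3, Set.indicator, net.stateProbExt_of_nonneg s, le_of_lt]
  rw [h2]
  congr 1
  simp only [nsmul_eq_mul, smul_eq_mul]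
  push_cast
  ring

lemma Lam_nonneg (j : Tier) (s : LinkState) {r : ℝ} (hr : 0 ≤ r) : 0 ≤ net.Lam j s r :=
  mul_nonneg (mul_nonneg (by positivity) (net.density_pos j).le)
    (intervalIntegral.integral_nonneg hr fun _ hx =>
      mul_nonneg hx.1 (net.stateProb_nonneg s hx.1))

/-- The probability that a BS of tier `j` located at `x` does not violate the radii `ρ`, i.e. that
its distance is at least the radius prescribed for its state. -/
def retainProb (ρ : Tier → LinkState → ℝ) (j : Tier) (x : Plane) : ENNReal :=
  ∑ s, if ρ j s ≤ ‖x‖ then ENNReal.ofReal (net.stateProb s ‖x‖) else 0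

lemma measurable_retainTerm (ρ : Tier → LinkState → ℝ) (j : Tier) (s : LinkState) :
    Measurable fun x : Plane =>
      if ρ j s ≤ ‖x‖ then ENNReal.ofReal (net.stateProb s ‖x‖) else 0 :=
  Measurable.ite (measurableSet_le measurable_const measurable_norm)
    (net.measurable_stateProb_norm s).ennreal_ofReal measurable_const

lemma measurable_retainProb (ρ : Tier → LinkState → ℝ) (j : Tier) :
    Measurable (net.retainProb ρ j) :=
  Finset.measurable_sum _ fun s _ => net.measurable_retainTerm ρ j s

lemma sum_stateProb (x : Plane) :
    ∑ s, ENNReal.ofReal (net.stateProb s ‖x‖) = 1 := by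
  rw [sum_linkState, ← ENNReal.ofReal_add (net.stateProb_nonneg _ (norm_nonneg x))
    (net.stateProb_nonneg _ (norm_nonneg x))]
  simp [stateProb]

/-- Each state contributes its probability to exactly one of the two sums. -/
lemma retainProb_add (ρ : Tier → LinkState → ℝ) (j : Tier) (x : Plane) :
    net.retainProb ρ j x +
      ∑ s, (if ‖x‖ < ρ j s then ENNReal.ofReal (net.stateProb s ‖x‖) else 0) = 1 := by
  rw [retainProb, ← Finset.sum_add_distrib, ← net.sum_stateProb x]
  refine Finset.sum_congr rfl fun s _ => ?_
  by_cases h : ρ j s ≤ ‖x‖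
  · simp [h, h.not_gt]
  · simp [h, not_le.1 h]

lemma retainProb_le_one (ρ : Tier → LinkState → ℝ) (j : Tier) (x : Plane) :
    net.retainProb ρ j x ≤ 1 :=
  (net.retainProb_add ρ j x).le.trans' le_self_add

lemma one_sub_retainProb (ρ : Tier → LinkState → ℝ) (j : Tier) (x : Plane) :
    1 - net.retainProb ρ j x =
      ∑ s, (if ‖x‖ < ρ j s then ENNReal.ofReal (net.stateProb s ‖x‖) else 0) := by
  rw [← net.retainProb_add ρ j x]
  exact ENNReal.add_sub_cancel_left
    (ne_top_of_le_ne_top ENNReal.one_ne_top (net.retainProb_le_one ρ j x))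

/-! ### Void probabilities of the marked network. -/

section Model

variable {net} {Ω : Type*} [MeasurableSpace Ω] {μ : Measure Ω}
  {X : Tier → ℕ → Ω → Plane} {S : Tier → ℕ → Ω → LinkState}

lemma IsModel.measurableSet_radii (h : net.IsModel X S μ) (ρ : Tier → LinkState → ℝ) (j : Tier)
    (i : ℕ) : MeasurableSet {ω | ρ j (S j i ω) ≤ ‖X j i ω‖} := by
  have hρ : Measurable (ρ j) := fun _ _ => MeasurableSpace.measurableSet_top
  exact measurableSet_le (hρ.comp (h.measurable_state j i)) (h.measurable_location j i).norm

variable [IsProbabilityMeasure μ]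

/-- With the states fixed to σ, the distance constraints depend on the locations only, so the
conditional law of the states can be integrated over them. -/
lemma IsModel.measure_state_inter (h : net.IsModel X S μ) (ρ : Tier → LinkState → ℝ)
    (F : Finset (Tier × ℕ)) (σ : Tier × ℕ → LinkState) :
    μ ({ω | ∀ p ∈ F, S p.1 p.2 ω = σ p} ∩ {ω | ∀ p ∈ F, ρ p.1 (σ p) ≤ ‖X p.1 p.2 ω‖}) =
      ∫⁻ ω, ∏ p ∈ F, (if ρ p.1 (σ p) ≤ ‖X p.1 p.2 ω‖ then
        ENNReal.ofReal (net.stateProb (σ p) ‖X p.1 p.2 ω‖) else 0) ∂μ := by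
  classical
  set A := {ω | ∀ p ∈ F, S p.1 p.2 ω = σ p}
  set C := {ω | ∀ p ∈ F, ρ p.1 (σ p) ≤ ‖X p.1 p.2 ω‖}
  have hm : MeasurableSpace.comap (fun ω j i => X j i ω) MeasurableSpace.pi ≤
      ‹MeasurableSpace Ω› := by
    refine Measurable.comap_le (measurable_pi_iff.2 fun j => measurable_pi_iff.2 fun i => ?_)
    exact h.measurable_location j i
  have hC : MeasurableSet[MeasurableSpace.comap (fun ω j i => X j i ω) MeasurableSpace.pi] C := by
    refine ⟨⋂ p ∈ F, {x : Tier → ℕ → Plane | ρ p.1 (σ p) ≤ ‖x p.1 p.2‖}, ?_, by ext; simp [C]⟩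
    exact MeasurableSet.biInter F.countable_toSet fun p _ => measurableSet_le measurable_const
      ((measurable_pi_apply p.2).comp (measurable_pi_apply p.1)).norm
  have hA : MeasurableSet A := by
    have : A = ⋂ p ∈ F, S p.1 p.2 ⁻¹' {σ p} := by ext; simp [A]
    rw [this]
    exact MeasurableSet.biInter F.countable_toSet fun p _ =>
      h.measurable_state _ _ (MeasurableSpace.measurableSet_top)
  have hint : Integrable (A.indicator fun _ => (1 : ℝ)) μ := (integrable_const 1).indicator hA
  have e1 := setIntegral_condExp hm hint hC
  rw [setIntegral_congr_ae (g := fun ω => ∏ p ∈ F, net.stateProb (σ p) ‖X p.1 p.2 ω‖) (hm _ hC)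
    ((h.condLaw_state F σ).mono fun ω hω _ => hω), setIntegral_indicator hA,
    setIntegral_const, smul_eq_mul, mul_one] at e1
  have hmeas : Measurable fun ω => ∏ p ∈ F, net.stateProb (σ p) ‖X p.1 p.2 ω‖ :=
    Finset.measurable_prod _ fun p _ =>
      (net.measurable_stateProb_norm (σ p)).comp (h.measurable_location _ _)
  have h0 : ∀ ω, ∀ p ∈ F, 0 ≤ net.stateProb (σ p) ‖X p.1 p.2 ω‖ := fun ω p _ =>
    net.stateProb_nonneg _ (norm_nonneg _)
  have hint2 : Integrable (fun ω => ∏ p ∈ F, net.stateProb (σ p) ‖X p.1 p.2 ω‖) (μ.restrict C) := by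
    refine (integrable_const (1 : ℝ)).mono' hmeas.aestronglyMeasurable (ae_of_all _ fun ω => ?_)
    rw [Real.norm_of_nonneg (Finset.prod_nonneg (h0 ω))]
    exact Finset.prod_le_one (h0 ω) fun p _ => net.stateProb_le_one _ (norm_nonneg _)
  have e2 := ofReal_integral_eq_lintegral_ofReal hint2
    (ae_of_all _ fun ω => Finset.prod_nonneg (h0 ω))
  rw [e1, ofReal_measureReal, ← lintegral_indicator (hm _ hC)] at e2
  rw [Set.inter_comm, e2]
  refine lintegral_congr fun ω => ?_
  by_cases hω : ω ∈ C
  · rw [Set.indicator_of_mem hω, ENNReal.ofReal_prod_of_nonneg (h0 ω)]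
    exact Finset.prod_congr rfl fun p hp => (if_pos (hω p hp)).symm
  · rw [Set.indicator_of_notMem hω]
    simp only [C, Set.mem_ofPred_eq, not_forall] at hω
    obtain ⟨p, hp, hlt⟩ := hω
    exact (Finset.prod_eq_zero hp (if_neg hlt)).symm

lemma IsModel.measure_forall_mem_radii (h : net.IsModel X S μ) (ρ : Tier → LinkState → ℝ)
    (F : Finset (Tier × ℕ)) :
    μ {ω | ∀ p ∈ F, ρ p.1 (S p.1 p.2 ω) ≤ ‖X p.1 p.2 ω‖} =
      ∫⁻ ω, ∏ p ∈ F, net.retainProb ρ p.1 (X p.1 p.2 ω) ∂μ := by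
  classical
  -- The event is partitioned by the set T of LOS links in `F`; this matches the expansion of a
  -- product of binary sums over subsets (`Finset.prod_add`).
  let σ : Finset (Tier × ℕ) → Tier × ℕ → LinkState := fun T p => if p ∈ T then .los else .nlos
  let A : Finset (Tier × ℕ) → Set Ω := fun T => {ω | ∀ p ∈ F, S p.1 p.2 ω = σ T p} ∩
    {ω | ∀ p ∈ F, ρ p.1 (σ T p) ≤ ‖X p.1 p.2 ω‖}
  have hunion : {ω | ∀ p ∈ F, ρ p.1 (S p.1 p.2 ω) ≤ ‖X p.1 p.2 ω‖} = ⋃ T ∈ F.powerset, A T := by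
    ext ω
    simp only [Set.mem_iUnion, Set.mem_ofPred_eq, A, Set.mem_inter_iff]
    constructor
    · intro hω
      have hσ : ∀ p ∈ F, S p.1 p.2 ω = σ (F.filter fun p => S p.1 p.2 ω = .los) p := by
        intro p hp
        rcases hs : S p.1 p.2 ω <;> simp [σ, hp, hs]
      exact ⟨_, Finset.mem_powerset.2 (Finset.filter_subset _ _), hσ,
        fun p hp => hσ p hp ▸ hω p hp⟩
    · rintro ⟨T, -, h1, h2⟩ p hp
      rw [h1 p hp]
      exact h2 p hp
  have hdisj : Set.PairwiseDisjoint (F.powerset : Set (Finset (Tier × ℕ))) A := by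
    intro T hT T' hT' hne
    refine Set.disjoint_left.2 fun ω h1 h2 => hne ?_
    have hT := Finset.mem_powerset.1 hT
    have hT' := Finset.mem_powerset.1 hT'
    ext p
    by_cases hp : p ∈ F
    · have := (h1.1 p hp).symm.trans (h2.1 p hp)
      by_cases ha : p ∈ T <;> by_cases hb : p ∈ T' <;> simp_all [σ]
    · exact iff_of_false (fun a => hp (hT a)) (fun a => hp (hT' a))
  have hmeas : ∀ T ∈ F.powerset, MeasurableSet (A T) := by
    intro T _
    refine MeasurableSet.inter ?_ ?_
    · have : {ω | ∀ p ∈ F, S p.1 p.2 ω = σ T p} = ⋂ p ∈ F, S p.1 p.2 ⁻¹' {σ T p} := by ext; simp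
      rw [this]
      exact MeasurableSet.biInter F.countable_toSet fun p _ =>
        h.measurable_state _ _ (MeasurableSpace.measurableSet_top)
    · have : {ω | ∀ p ∈ F, ρ p.1 (σ T p) ≤ ‖X p.1 p.2 ω‖} =
          ⋂ p ∈ F, {ω | ρ p.1 (σ T p) ≤ ‖X p.1 p.2 ω‖} := by ext; simp
      rw [this]
      exact MeasurableSet.biInter F.countable_toSet fun p _ =>
        measurableSet_le measurable_const (h.measurable_location _ _).norm
  rw [hunion, measure_biUnion_finset hdisj hmeas]
  simp_rw [A, h.measure_state_inter ρ F]
  rw [← lintegral_finsetSum]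
  · refine lintegral_congr fun ω => ?_
    simp_rw [retainProb, sum_linkState]
    rw [Finset.prod_add]
    refine Finset.sum_congr rfl fun T hT => ?_
    rw [← Finset.prod_sdiff (Finset.mem_powerset.1 hT), mul_comm]
    congr 1
    · exact Finset.prod_congr rfl fun p hp => by simp [σ, hp]
    · exact Finset.prod_congr rfl fun p hp => by simp [σ, (Finset.mem_sdiff.1 hp).2]
  · exact fun T _ => Finset.measurable_prod _ fun p _ =>
      (net.measurable_retainTerm ρ p.1 _).comp (h.measurable_location _ _)

/-- The probability that no BS of the network is closer to the user than the radius prescribed for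
its tier and state. -/
theorem IsModel.measure_forall_radii (h : net.IsModel X S μ) {ρ : Tier → LinkState → ℝ}
    (hρ : ∀ j s, 0 ≤ ρ j s) :
    μ {ω | ∀ j i, ρ j (S j i ω) ≤ ‖X j i ω‖} =
      ENNReal.ofReal (Real.exp (-∑ j, ∑ s, net.Lam j s (ρ j s))) := by
  classical
  -- Infinite where the retention probability vanishes, which is why the exponential is taken on
  -- `[0, ∞]`.
  let g : Tier → Plane → ENNReal := fun j x => (-(ENNReal.log (net.retainProb ρ j x))).toENNReal
  have hgm : ∀ j, Measurable (g j) := fun j =>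
    ((continuous_id.ereal_toENNReal.comp continuous_neg).measurable.comp
      ENNReal.measurable_log).comp (net.measurable_retainProb ρ j)
  have hg : ∀ j x, expNeg (g j x) = net.retainProb ρ j x := fun j x =>
    expNeg_neg_log (net.retainProb_le_one ρ j x)
  let F : ℕ → Finset (Tier × ℕ) := fun n => Finset.univ ×ˢ Finset.range n
  have hF : ∀ n, μ {ω | ∀ p ∈ F n, ρ p.1 (S p.1 p.2 ω) ≤ ‖X p.1 p.2 ω‖} =
      ∫⁻ ω, expNeg (∑ j, ∑ i ∈ Finset.range n, g j (X j i ω)) ∂μ := fun n => by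
    rw [h.measure_forall_mem_radii]
    refine lintegral_congr fun ω => ?_
    rw [Finset.prod_product]
    simp_rw [expNeg_sum, hg]
  have hlim1 : Filter.Tendsto (fun n => μ {ω | ∀ p ∈ F n, ρ p.1 (S p.1 p.2 ω) ≤ ‖X p.1 p.2 ω‖})
      Filter.atTop (nhds (μ {ω | ∀ j i, ρ j (S j i ω) ≤ ‖X j i ω‖})) := by
    have heq : {ω | ∀ j i, ρ j (S j i ω) ≤ ‖X j i ω‖} =
        ⋂ n, {ω | ∀ p ∈ F n, ρ p.1 (S p.1 p.2 ω) ≤ ‖X p.1 p.2 ω‖} := by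
      ext ω
      simp only [Set.mem_ofPred_eq, Set.mem_iInter]
      exact ⟨fun hω n p _ => hω p.1 p.2, fun hω j i => hω (i + 1) (j, i) (by simp [F])⟩
    rw [heq]
    refine tendsto_measure_iInter_atTop (fun n => ?_) (fun n m hnm ω hω p hp => hω p ?_)
      ⟨0, measure_ne_top _ _⟩
    · have : {ω | ∀ p ∈ F n, ρ p.1 (S p.1 p.2 ω) ≤ ‖X p.1 p.2 ω‖} =
          ⋂ p ∈ F n, {ω | ρ p.1 (S p.1 p.2 ω) ≤ ‖X p.1 p.2 ω‖} := by ext; simp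
      rw [this]
      exact (MeasurableSet.biInter (F n).countable_toSet fun p _ =>
        h.measurableSet_radii ρ p.1 p.2).nullMeasurableSet
    · simp only [F, Finset.mem_product, Finset.mem_range] at hp ⊢
      exact ⟨hp.1, hp.2.trans_le hnm⟩
  have hlim2 : Filter.Tendsto (fun n => ∫⁻ ω, expNeg (∑ j, ∑ i ∈ Finset.range n, g j (X j i ω)) ∂μ)
      Filter.atTop (nhds (∫⁻ ω, expNeg (∑ j, ∫⁻ x, g j x ∂(countingProcess (X j) ω)) ∂μ)) := by
    refine tendsto_lintegral_of_dominated_convergence (fun _ => 1) (fun n => ?_)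
      (fun n => ae_of_all _ fun ω => expNeg_le_one _) (by simp) (ae_of_all _ fun ω => ?_)
    · exact measurable_expNeg.comp (Finset.measurable_sum _ fun j _ =>
        Finset.measurable_sum _ fun i _ => (hgm j).comp (h.measurable_location j i))
    · refine (continuous_expNeg.tendsto _).comp (tendsto_finsetSum _ fun j _ => ?_)
      rw [lintegral_countingProcess _ (hgm j)]
      exact ENNReal.summable.hasSum.tendsto_sum_nat
  simp_rw [hF] at hlim1
  rw [tendsto_nhds_unique hlim1 hlim2]
  have hm : ∀ j, Measurable fun ν : Measure Plane => expNeg (∫⁻ x, g j x ∂ν) := fun j =>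
    measurable_expNeg.comp (Measure.measurable_lintegral (hgm j))
  have hm' : ∀ j, AEMeasurable (fun ω => expNeg (∫⁻ x, g j x ∂(countingProcess (X j) ω))) μ :=
    fun j => ((hm j).comp (h.poisson j).measurable).aemeasurable
  have hlap : ∀ j, ∫⁻ ω, expNeg (∫⁻ x, g j x ∂(countingProcess (X j) ω)) ∂μ =
      expNeg (∑ s, ENNReal.ofReal (net.Lam j s (ρ j s))) := fun j => by
    rw [(h.poisson j).lintegral_expNeg (hgm j)]
    · simp_rw [hg, one_sub_retainProb]
      rw [lintegral_finsetSum]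
      · simp_rw [net.lintegral_stateProb_ball j _ (hρ j _)]
      · exact fun s _ => Measurable.ite (measurableSet_lt measurable_norm measurable_const)
          (net.measurable_stateProb_norm s).ennreal_ofReal measurable_const
    · have hsub : {x | g j x ≠ 0} ⊆ Metric.ball 0 (∑ s, ρ j s) := by
        intro x hx
        by_contra hb
        refine hx ?_
        have hb' : ∀ s, ρ j s ≤ ‖x‖ := fun s =>
          (Finset.single_le_sum (fun s _ => hρ j s) (Finset.mem_univ s)).trans (by simpa using hb)
        have : net.retainProb ρ j x = 1 := by
          rw [retainProb]
          simp_rw [if_pos (hb' _)]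
          exact net.sum_stateProb x
        simp [g, this]
      refine ne_top_of_le_ne_top ?_ (measure_mono hsub)
      rw [Measure.smul_apply, smul_eq_mul]
      exact ENNReal.mul_ne_top ENNReal.ofReal_ne_top measure_ball_lt_top.ne
  have hind : IndepFun (fun ω => expNeg (∫⁻ x, g .macroBS x ∂(countingProcess (X .macroBS) ω)))
      (fun ω => expNeg (∫⁻ x, g .smallBS x ∂(countingProcess (X .smallBS) ω))) μ :=
    h.indep_tiers.comp (hm _) (hm _)
  simp_rw [expNeg_sum]
  have hprod : ∀ f : Tier → ENNReal, ∏ j, f j = f .macroBS * f .smallBS := fun f =>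
    Finset.prod_pair (by simp)
  simp_rw [hprod]
  rw [lintegral_mul_eq_lintegral_mul_lintegral_of_indepFun''
    (hm' _) (hm' _) hind, hlap, hlap, ← expNeg_add,
    ← sum_tier (fun j => ∑ s, ENNReal.ofReal (net.Lam j s (ρ j s)))]
  have h0 : ∀ j s, 0 ≤ net.Lam j s (ρ j s) := fun j s => net.Lam_nonneg j s (hρ j s)
  simp_rw [← ENNReal.ofReal_sum_of_nonneg fun s _ => h0 _ s]
  rw [← ENNReal.ofReal_sum_of_nonneg fun j _ => Finset.sum_nonneg fun s _ => h0 j s,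
    expNeg_ofReal (Finset.sum_nonneg fun j _ => Finset.sum_nonneg fun s _ => h0 j s)]

end Model

end Network

/-! ### Counts of a Poisson process in a set. -/

section Counting

variable {Ω E : Type*} [MeasurableSpace E]

lemma countingProcess_apply (Y : ℕ → Ω → E) (ω : Ω) {B : Set E} (hB : MeasurableSet B) :
    countingProcess Y ω B = ∑' i, B.indicator 1 (Y i ω) := by
  rw [countingProcess, Measure.sum_apply _ hB]
  exact tsum_congr fun i => Measure.dirac_apply' _ hB

lemma finite_of_countingProcess_ne_top {Y : ℕ → Ω → E} {ω : Ω} {B : Set E} (hB : MeasurableSet B)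
    (h : countingProcess Y ω B ≠ ⊤) : {i | Y i ω ∈ B}.Finite := by
  rw [countingProcess_apply Y ω hB] at h
  refine (ENNReal.finite_const_le_of_tsum_ne_top h one_ne_zero).subset fun i hi => ?_
  simp only [Set.mem_ofPred_eq] at hi ⊢
  simp [hi]

lemma notMem_of_countingProcess_eq_zero {Y : ℕ → Ω → E} {ω : Ω} {B : Set E}
    (hB : MeasurableSet B) (h : countingProcess Y ω B = 0) (i : ℕ) : Y i ω ∉ B := by
  rw [countingProcess_apply Y ω hB, ENNReal.tsum_eq_zero] at h
  intro hi
  simpa [hi] using h i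

lemma two_le_countingProcess {Y : ℕ → Ω → E} {ω : Ω} {B : Set E} (hB : MeasurableSet B) {i i' : ℕ}
    (hne : i ≠ i') (hi : Y i ω ∈ B) (hi' : Y i' ω ∈ B) : 2 ≤ countingProcess Y ω B := by
  classical
  rw [countingProcess_apply Y ω hB]
  refine le_trans ?_ (ENNReal.sum_le_tsum {i, i'})
  rw [Finset.sum_pair hne]
  simp [hi, hi', one_add_one_eq_two]

variable [MeasurableSpace Ω] {μ : Measure Ω}

lemma IsPoissonProcess.measure_preimage {N : Ω → Measure E} {Λ : Measure E}
    (h : IsPoissonProcess N Λ μ) {B : Set E} (hB : MeasurableSet B) (hΛ : Λ B ≠ ⊤)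
    {A : Set ENNReal} (hA : MeasurableSet A) :
    μ {ω | N ω B ∈ A} = poissonMeasure (Λ B).toNNReal {n | (n : ENNReal) ∈ A} := by
  have := DFunLike.congr_fun (h.hasLaw B hB hΛ).map_eq A
  rwa [Measure.map_apply (h.measurable_apply hB) hA,
    Measure.map_apply (measurable_of_countable _) hA] at this

lemma IsPoissonProcess.ae_ne_top {N : Ω → Measure E} {Λ : Measure E}
    (h : IsPoissonProcess N Λ μ) {B : Set E} (hB : MeasurableSet B) (hΛ : Λ B ≠ ⊤) :
    ∀ᵐ ω ∂μ, N ω B ≠ ⊤ := by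
  have := h.measure_preimage hB hΛ (measurableSet_singleton ⊤)
  simpa [ae_iff] using this

/-- From exp(-m) ≥ 1 - m one gets 1 - (1 + m) exp(-m) ≤ m². -/
lemma IsPoissonProcess.measure_two_le {N : Ω → Measure E} {Λ : Measure E}
    (h : IsPoissonProcess N Λ μ) {B : Set E} (hB : MeasurableSet B) (hΛ : Λ B ≠ ⊤) :
    μ {ω | 2 ≤ N ω B} ≤ ENNReal.ofReal ((Λ B).toReal ^ 2) := by
  have h1 := h.measure_preimage hB hΛ (measurableSet_Ici (a := (2 : ENNReal)))
  simp only [Set.mem_Ici] at h1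
  rw [h1]
  set m := (Λ B).toNNReal
  have h2 : {n : ℕ | (2 : ENNReal) ≤ n} = (({0, 1} : Finset ℕ) : Set ℕ)ᶜ := by
    ext n
    simp only [Set.mem_ofPred_eq, Finset.coe_insert, Finset.coe_singleton, Set.mem_compl_iff,
      Set.mem_insert_iff, Set.mem_singleton_iff]
    have : (2 : ENNReal) ≤ n ↔ 2 ≤ n := by exact_mod_cast Iff.rfl
    rw [this]
    omega
  rw [h2, ← ofReal_measureReal]
  refine ENNReal.ofReal_le_ofReal ?_
  rw [probReal_compl_eq_one_sub (Finset.measurableSet _), ← sum_measureReal_singleton,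
    Finset.sum_pair (by norm_num), poissonMeasure_real_singleton, poissonMeasure_real_singleton]
  have h3 := Real.add_one_le_exp (-(m : ℝ))
  have h4 : (0 : ℝ) ≤ m := m.coe_nonneg
  change _ ≤ (m : ℝ) ^ 2
  simp only [pow_zero, pow_one, Nat.factorial_zero, Nat.factorial_one, Nat.cast_one, div_one,
    mul_one]
  nlinarith

lemma IsPoissonProcess.ae_eq_zero {N : Ω → Measure E} {Λ : Measure E}
    (h : IsPoissonProcess N Λ μ) {B : Set E} (hB : MeasurableSet B) (hΛ : Λ B = 0) :
    ∀ᵐ ω ∂μ, N ω B = 0 := by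
  have h1 := h.measure_preimage hB (by simp [hΛ]) (measurableSet_singleton (0 : ENNReal)).compl
  have h2 : {n : ℕ | (n : ENNReal) ∈ ({0} : Set ENNReal)ᶜ} = {0}ᶜ := by ext; simp
  rw [h2, prob_compl_eq_one_sub (measurableSet_singleton _), poissonMeasure_singleton] at h1
  simpa [ae_iff, hΛ] using h1

end Counting

/-! ### Almost sure geometry: no ties, no point at the origin, local finiteness. -/

section Ties

variable {Ω : Type*} [MeasurableSpace Ω] {μ : Measure Ω} {Y : ℕ → Ω → Plane} {δ : ℝ}

/-- The annulus of the points whose squared norm is in `[a, b)`. -/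
def annulus (a b : ℝ) : Set Plane := {x | a ≤ ‖x‖ ^ 2 ∧ ‖x‖ ^ 2 < b}

lemma measurableSet_annulus (a b : ℝ) : MeasurableSet (annulus a b) :=
  (measurableSet_le measurable_const (measurable_norm.pow_const 2)).inter
    (measurableSet_lt (measurable_norm.pow_const 2) measurable_const)

/-- Indexing by the squared norm makes the area linear in b - a, so equal steps give equal areas. -/
lemma volume_annulus {a b : ℝ} (ha : 0 ≤ a) (hab : a ≤ b) :
    volume (annulus a b) = ENNReal.ofReal ((b - a) * Real.pi) := by
  have h1 : annulus a b = Metric.ball 0 (√b) \ Metric.ball 0 (√a) := by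
    ext x
    simp only [annulus, Set.mem_ofPred_eq, Set.mem_sdiff, mem_ball_zero_iff, not_lt]
    rw [Real.lt_sqrt (norm_nonneg x), Real.sqrt_le_left (norm_nonneg x), and_comm]
  have h2 : ∀ c : ℝ, 0 ≤ c → volume (Metric.ball (0 : Plane) (√c)) = ENNReal.ofReal (c * Real.pi) := by
    intro c hc
    rw [EuclideanSpace.volume_ball_fin_two, ← ENNReal.ofReal_pow (Real.sqrt_nonneg _),
      Real.sq_sqrt hc, ENNReal.ofReal_mul hc]
  rw [h1, measure_sdiff (Metric.ball_subset_ball (Real.sqrt_le_sqrt hab))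
    measurableSet_ball.nullMeasurableSet measure_ball_lt_top.ne, h2 b (ha.trans hab), h2 a ha,
    ← ENNReal.ofReal_sub _ (by positivity), sub_mul]

/-- Almost surely, no two points of a homogeneous Poisson process are equidistant from the
origin. -/
lemma ae_norm_ne_of_isPoissonProcess
    (h : IsPoissonProcess (countingProcess Y) (ENNReal.ofReal δ • (volume : Measure Plane)) μ)
    (hδ : 0 ≤ δ) : ∀ᵐ ω ∂μ, ∀ i i', i ≠ i' → ‖Y i ω‖ ≠ ‖Y i' ω‖ := by
  have key : ∀ M : ℕ, ∀ᵐ ω ∂μ, ∀ i i', i ≠ i' → ‖Y i ω‖ ^ 2 < M → ‖Y i ω‖ ≠ ‖Y i' ω‖ := by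
    intro M
    set bad := {ω | ¬ ∀ i i', i ≠ i' → ‖Y i ω‖ ^ 2 < M → ‖Y i ω‖ ≠ ‖Y i' ω‖} with hbad
    -- Equidistant points share an annulus. There are M(n + 1) annuli, each holding two points with
    -- probability at most (δπ/(n + 1))², so the total is O(1/n).
    have hn : ∀ n : ℕ, μ bad ≤ ENNReal.ofReal (M * (δ * Real.pi) ^ 2 / (n + 1 : ℝ)) := by
      intro n
      have hn0 : (0 : ℝ) < n + 1 := by positivity
      let B : ℕ → Set Plane := fun l => annulus (l / (n + 1)) ((l + 1) / (n + 1))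
      have hB : ∀ l, (ENNReal.ofReal δ • (volume : Measure Plane)) (B l) =
          ENNReal.ofReal (δ * Real.pi / (n + 1)) := by
        intro l
        rw [Measure.smul_apply, volume_annulus (by positivity) (by gcongr; linarith), smul_eq_mul,
          ← ENNReal.ofReal_mul hδ]
        congr 1
        field_simp
        ring
      have hsub : bad ⊆ ⋃ l ∈ Finset.range (M * (n + 1)), {ω | 2 ≤ countingProcess Y ω (B l)} := by
        intro ω hω
        simp only [hbad, Set.mem_ofPred_eq, not_forall, not_not] at hω
        obtain ⟨i, i', hne, hlt, heq⟩ := hω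
        have h0 : 0 ≤ ‖Y i ω‖ ^ 2 * (n + 1) := by positivity
        have hmem : Y i ω ∈ B ⌊‖Y i ω‖ ^ 2 * (n + 1)⌋₊ := by
          refine ⟨?_, ?_⟩
          · rw [div_le_iff₀ hn0]
            exact Nat.floor_le h0
          · rw [lt_div_iff₀ hn0]
            exact Nat.lt_floor_add_one _
        have hmem' : Y i' ω ∈ B ⌊‖Y i ω‖ ^ 2 * (n + 1)⌋₊ := by
          simpa only [B, annulus, Set.mem_ofPred_eq, heq] using hmem
        simp only [Set.mem_iUnion, Finset.mem_range]
        refine ⟨_, ?_, two_le_countingProcess (measurableSet_annulus _ _) hne hmem hmem'⟩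
        rw [Nat.floor_lt h0]
        push_cast
        gcongr
      calc μ bad ≤ ∑ l ∈ Finset.range (M * (n + 1)), μ {ω | 2 ≤ countingProcess Y ω (B l)} :=
            (measure_mono hsub).trans (measure_biUnion_finset_le _ _)
        _ ≤ ∑ l ∈ Finset.range (M * (n + 1)), ENNReal.ofReal ((δ * Real.pi / (n + 1)) ^ 2) := by
            refine Finset.sum_le_sum fun l _ => ?_
            have := h.measure_two_le (measurableSet_annulus (l / (n + 1)) ((l + 1) / (n + 1)))
              (by rw [hB l]; exact ENNReal.ofReal_ne_top)
            rwa [hB l, ENNReal.toReal_ofReal (by positivity)] at this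
        _ = ENNReal.ofReal (M * (δ * Real.pi) ^ 2 / (n + 1 : ℝ)) := by
            rw [Finset.sum_const, Finset.card_range, nsmul_eq_mul, ← ENNReal.ofReal_natCast,
              ← ENNReal.ofReal_mul (by positivity)]
            congr 1
            push_cast
            field_simp
    have hlim : Filter.Tendsto (fun n : ℕ => ENNReal.ofReal (M * (δ * Real.pi) ^ 2 / (n + 1 : ℝ)))
        Filter.atTop (nhds 0) := by
      rw [← ENNReal.ofReal_zero]
      refine (ENNReal.continuous_ofReal.tendsto 0).comp ?_
      exact tendsto_const_nhds.div_atTop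
        (Filter.tendsto_atTop_add_const_right _ _ tendsto_natCast_atTop_atTop)
    exact le_antisymm (ge_of_tendsto' hlim hn) bot_le
  filter_upwards [ae_all_iff.2 key] with ω hω i i' hne
  obtain ⟨M, hM⟩ := exists_nat_gt (‖Y i ω‖ ^ 2)
  exact hω M i i' hne hM

lemma ae_norm_pos_of_isPoissonProcess
    (h : IsPoissonProcess (countingProcess Y) (ENNReal.ofReal δ • (volume : Measure Plane)) μ) :
    ∀ᵐ ω ∂μ, ∀ i, 0 < ‖Y i ω‖ := by
  filter_upwards [h.ae_eq_zero (measurableSet_singleton (0 : Plane)) (by simp)] with ω hω i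
  exact norm_pos_iff.2 (notMem_of_countingProcess_eq_zero (measurableSet_singleton _) hω i)

lemma ae_finite_of_isPoissonProcess
    (h : IsPoissonProcess (countingProcess Y) (ENNReal.ofReal δ • (volume : Measure Plane)) μ) :
    ∀ᵐ ω ∂μ, ∀ r : ℝ, {i | ‖Y i ω‖ < r}.Finite := by
  have : ∀ n : ℕ, ∀ᵐ ω ∂μ, countingProcess Y ω (Metric.ball 0 n) ≠ ⊤ := fun n =>
    h.ae_ne_top measurableSet_ball (by
      rw [Measure.smul_apply, smul_eq_mul]
      exact ENNReal.mul_ne_top ENNReal.ofReal_ne_top measure_ball_lt_top.ne)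
  filter_upwards [ae_all_iff.2 this] with ω hω r
  obtain ⟨n, hn⟩ := exists_nat_gt r
  refine (finite_of_countingProcess_ne_top measurableSet_ball (hω n)).subset fun i hi => ?_
  simp only [Set.mem_ofPred_eq, mem_ball_zero_iff] at hi ⊢
  exact hi.trans hn

end Ties

/-! ### Comparing two random times through their joint survival function. -/

section Survival

lemma borel_ennreal_eq_generateFrom_Ici_ofReal :
    (inferInstance : MeasurableSpace ENNReal) =
      MeasurableSpace.generateFrom {B | ∃ a : ℝ, 0 ≤ a ∧ B = Set.Ici (ENNReal.ofReal a)} := by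
  refine le_antisymm ?_ (MeasurableSpace.generateFrom_le ?_)
  · rw [BorelSpace.measurable_eq (α := ENNReal), borel_eq_generateFrom_Ici]
    refine MeasurableSpace.generateFrom_le ?_
    rintro _ ⟨a, rfl⟩
    rcases eq_or_ne a ⊤ with rfl | ha
    · have : Set.Ici (⊤ : ENNReal) = ⋂ n : ℕ, Set.Ici (ENNReal.ofReal n) := by
        ext x
        simp only [Set.mem_Ici, top_le_iff, Set.mem_iInter, ENNReal.ofReal_natCast]
        exact ⟨fun h n => h ▸ le_top, ENNReal.eq_top_of_forall_nnreal_le ∘ fun h r =>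
          (ENNReal.coe_le_coe.2 (Nat.le_ceil r)).trans (by simpa using h ⌈r⌉₊)⟩
      rw [this]
      exact MeasurableSet.iInter fun n =>
        MeasurableSpace.measurableSet_generateFrom ⟨n, n.cast_nonneg, rfl⟩
    · exact MeasurableSpace.measurableSet_generateFrom
        ⟨a.toReal, ENNReal.toReal_nonneg, by rw [ENNReal.ofReal_toReal ha]⟩
  · rintro _ ⟨a, -, rfl⟩
    exact measurableSet_Ici

lemma isPiSystem_Ici_ofReal :
    IsPiSystem {B | ∃ a : ℝ, 0 ≤ a ∧ B = Set.Ici (ENNReal.ofReal a)} := by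
  rintro _ ⟨a, ha, rfl⟩ _ ⟨b, hb, rfl⟩ -
  refine ⟨max a b, le_max_of_le_left ha, ?_⟩
  rw [Set.Ici_inter_Ici, ENNReal.ofReal_max]

lemma ofReal_max_zero (a : ℝ) : ENNReal.ofReal (max a 0) = ENNReal.ofReal a := by
  simp

variable {Ω : Type*} [MeasurableSpace Ω] {μ : Measure Ω} {τ₁ τ₂ : Ω → ENNReal} {F G : ℝ → ℝ}

/-- Continuity of G removes the difference between ≤ and <: the strict event is the increasing union
of weak ones at x + 1/(n + 1). -/
lemma measure_ofReal_lt
    (hG : ∀ b, 0 ≤ b → μ {ω | ENNReal.ofReal b ≤ τ₂ ω} = ENNReal.ofReal (G b))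
    (hGc : ContinuousOn G (Set.Ici 0)) {x : ℝ} (hx : 0 ≤ x) :
    μ {ω | ENNReal.ofReal x < τ₂ ω} = ENNReal.ofReal (G x) := by
  have hy : ∀ n : ℕ, 0 ≤ x + 1 / ((n : ℝ) + 1) := fun n => by positivity
  have hlim : Filter.Tendsto (fun n : ℕ => x + 1 / ((n : ℝ) + 1)) Filter.atTop (nhds x) := by
    simpa using tendsto_one_div_add_atTop_nhds_zero_nat.const_add x
  have hU : {ω | ENNReal.ofReal x < τ₂ ω} =
      ⋃ n : ℕ, {ω | ENNReal.ofReal (x + 1 / ((n : ℝ) + 1)) ≤ τ₂ ω} := by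
    ext ω
    simp only [Set.mem_ofPred_eq, Set.mem_iUnion]
    constructor
    · intro h
      have := ((ENNReal.continuous_ofReal.tendsto x).comp hlim).eventually_lt_const h
      exact (this.exists).imp fun n hn => hn.le
    · rintro ⟨n, hn⟩
      refine lt_of_lt_of_le ?_ hn
      exact (ENNReal.ofReal_lt_ofReal_iff_of_nonneg hx).2 (lt_add_of_pos_right _ (by positivity))
  have hmono : Monotone fun n : ℕ => {ω | ENNReal.ofReal (x + 1 / ((n : ℝ) + 1)) ≤ τ₂ ω} := by
    intro n m hnm ω hω
    refine le_trans (ENNReal.ofReal_le_ofReal ?_) hω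
    gcongr
  have h1 : Filter.Tendsto (fun n : ℕ => μ {ω | ENNReal.ofReal (x + 1 / ((n : ℝ) + 1)) ≤ τ₂ ω})
      Filter.atTop (nhds (μ {ω | ENNReal.ofReal x < τ₂ ω})) :=
    hU ▸ tendsto_measure_iUnion_atTop (μ := μ) hmono
  simp_rw [hG _ (hy _)] at h1
  refine tendsto_nhds_unique h1 ((ENNReal.continuous_ofReal.tendsto _).comp ?_)
  refine ((hGc x hx).tendsto).comp (tendsto_nhdsWithin_iff.2 ⟨hlim, Filter.Eventually.of_forall hy⟩)

variable [IsProbabilityMeasure μ]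

/-- The half-lines `[a, ∞]` with finite a ≥ 0 form a π-system generating the Borel sets of `[0, ∞]`.
-/
lemma indepFun_of_survival (h₁ : Measurable τ₁) (h₂ : Measurable τ₂)
    (hjoint : ∀ a b, 0 ≤ a → 0 ≤ b →
      μ {ω | ENNReal.ofReal a ≤ τ₁ ω ∧ ENNReal.ofReal b ≤ τ₂ ω} =
        μ {ω | ENNReal.ofReal a ≤ τ₁ ω} * μ {ω | ENNReal.ofReal b ≤ τ₂ ω}) :
    IndepFun τ₁ τ₂ μ := by
  rw [IndepFun_iff_Indep]
  refine IndepSets.indep h₁.comap_le h₂.comap_le (isPiSystem_Ici_ofReal.comap τ₁)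
    (isPiSystem_Ici_ofReal.comap τ₂) ?_ ?_ ?_
  · conv_lhs => rw [show (ENNReal.measurableSpace : MeasurableSpace ENNReal) = _ from
      borel_ennreal_eq_generateFrom_Ici_ofReal, MeasurableSpace.comap_generateFrom]
    rfl
  · conv_lhs => rw [show (ENNReal.measurableSpace : MeasurableSpace ENNReal) = _ from
      borel_ennreal_eq_generateFrom_Ici_ofReal, MeasurableSpace.comap_generateFrom]
    rfl
  · rw [IndepSets_iff]
    rintro _ _ ⟨_, ⟨a, ha, rfl⟩, rfl⟩ ⟨_, ⟨b, hb, rfl⟩, rfl⟩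
    exact hjoint a b ha hb

/-- Both measures agree on intervals [a, b). Restricting to τ₁ < ∞ discards the possible atom at ∞,
which `toReal` would send to 0. -/
lemma map_toReal_restrict_of_survival (h₁ : Measurable τ₁)
    (hF : ∀ a, 0 ≤ a → μ {ω | ENNReal.ofReal a ≤ τ₁ ω} = ENNReal.ofReal (F a)) {f : ℝ → ENNReal}
    (hf : ∀ a b, 0 ≤ a → a ≤ b →
      ∫⁻ x in Set.Ico a b, f x = ENNReal.ofReal (F a) - ENNReal.ofReal (F b)) :
    (μ.restrict {ω | τ₁ ω < ⊤}).map (fun ω => (τ₁ ω).toReal) =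
      (volume.restrict (Set.Ici 0)).withDensity f := by
  refine Measure.ext_of_Ico _ _ fun a b hab => ?_
  have hm : Measurable fun ω => (τ₁ ω).toReal := h₁.ennreal_toReal
  rw [Measure.map_apply hm measurableSet_Ico, Measure.restrict_apply (hm measurableSet_Ico),
    withDensity_apply _ measurableSet_Ico, Measure.restrict_restrict measurableSet_Ico]
  have h1 : (fun ω => (τ₁ ω).toReal) ⁻¹' Set.Ico a b ∩ {ω | τ₁ ω < ⊤} =
      {ω | ENNReal.ofReal (max a 0) ≤ τ₁ ω} \ {ω | ENNReal.ofReal (max b 0) ≤ τ₁ ω} := by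
    ext ω
    simp only [Set.mem_inter_iff, Set.mem_preimage, Set.mem_Ico, Set.mem_ofPred_eq, Set.mem_sdiff,
      not_le, ofReal_max_zero]
    constructor
    · rintro ⟨⟨h1, h2⟩, h3⟩
      exact ⟨(ENNReal.ofReal_le_iff_le_toReal h3.ne).2 h1, (ENNReal.lt_ofReal_iff_toReal_lt h3.ne).2 h2⟩
    · rintro ⟨h1, h2⟩
      have h3 : τ₁ ω < ⊤ := h2.trans ENNReal.ofReal_lt_top
      exact ⟨⟨(ENNReal.ofReal_le_iff_le_toReal h3.ne).1 h1,
        (ENNReal.lt_ofReal_iff_toReal_lt h3.ne).1 h2⟩, h3⟩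
  have h2 : Set.Ico a b ∩ Set.Ici 0 = Set.Ico (max a 0) (max b 0) := by
    ext x
    simp only [Set.mem_inter_iff, Set.mem_Ico, Set.mem_Ici, max_le_iff, lt_max_iff]
    constructor
    · rintro ⟨⟨h1, h2⟩, h3⟩
      exact ⟨⟨h1, h3⟩, Or.inl h2⟩
    · rintro ⟨⟨h1, h3⟩, h2⟩
      exact ⟨⟨h1, h2.resolve_right h3.not_gt⟩, h3⟩
  have hle : max a 0 ≤ max b 0 := max_le_max_right 0 hab.le
  rw [h1, h2, hf _ _ (le_max_right _ _) hle, measure_sdiff _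
    (measurableSet_le measurable_const h₁).nullMeasurableSet (measure_ne_top _ _),
    hF _ (le_max_right _ _), hF _ (le_max_right _ _)]
  exact fun ω hω => (ENNReal.ofReal_le_ofReal hle).trans hω

/-- The probability that one of two random times precedes the other, in terms of their joint
survival function. -/
theorem measure_lt_of_survival (h₁ : Measurable τ₁) (h₂ : Measurable τ₂)
    (hjoint : ∀ a b, 0 ≤ a → 0 ≤ b →
      μ {ω | ENNReal.ofReal a ≤ τ₁ ω ∧ ENNReal.ofReal b ≤ τ₂ ω} =
        ENNReal.ofReal (F a) * ENNReal.ofReal (G b))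
    (hF0 : F 0 = 1) (hG0 : G 0 = 1) (hGc : ContinuousOn G (Set.Ici 0)) {f : ℝ → ENNReal}
    (hfm : Measurable f)
    (hf : ∀ a b, 0 ≤ a → a ≤ b →
      ∫⁻ x in Set.Ico a b, f x = ENNReal.ofReal (F a) - ENNReal.ofReal (F b)) :
    μ {ω | τ₁ ω < τ₂ ω} = ∫⁻ x in Set.Ioi 0, f x * ENNReal.ofReal (G x) := by
  have hF : ∀ a, 0 ≤ a → μ {ω | ENNReal.ofReal a ≤ τ₁ ω} = ENNReal.ofReal (F a) := fun a ha => by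
    simpa [hG0] using hjoint a 0 ha le_rfl
  have hG : ∀ b, 0 ≤ b → μ {ω | ENNReal.ofReal b ≤ τ₂ ω} = ENNReal.ofReal (G b) := fun b hb => by
    simpa [hF0] using hjoint 0 b le_rfl hb
  have hind : IndepFun τ₁ τ₂ μ := indepFun_of_survival h₁ h₂ fun a b ha hb => by
    rw [hjoint a b ha hb, hF a ha, hG b hb]
  have hprod := (indepFun_iff_map_prod_eq_prod_map_map h₁.aemeasurable h₂.aemeasurable).1 hind
  set K : ENNReal → ENNReal := fun t => μ {ω | t < τ₂ ω} with hK
  have hKm : Measurable K := by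
    refine Antitone.measurable fun s t hst => measure_mono fun ω hω => ?_
    exact lt_of_le_of_lt hst hω
  have hlt : MeasurableSet {p : ENNReal × ENNReal | p.1 < p.2} :=
    measurableSet_lt measurable_fst measurable_snd
  have e1 : μ {ω | τ₁ ω < τ₂ ω} = ∫⁻ ω, K (τ₁ ω) ∂μ := by
    rw [← lintegral_map hKm h₁]
    have : μ {ω | τ₁ ω < τ₂ ω} = (μ.map fun ω => (τ₁ ω, τ₂ ω)) {p | p.1 < p.2} := by
      rw [Measure.map_apply (h₁.prodMk h₂) hlt]
      rfl
    rw [this, hprod, Measure.prod_apply hlt]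
    refine lintegral_congr fun t => ?_
    rw [Measure.map_apply h₂ (measurable_prodMk_left hlt)]
    rfl
  have hfin : MeasurableSet {ω | τ₁ ω < ⊤} := measurableSet_lt h₁ measurable_const
  -- Nothing exceeds ∞, so K vanishes there and the atom contributes nothing.
  have e2 : ∫⁻ ω, K (τ₁ ω) ∂μ = ∫⁻ ω in {ω | τ₁ ω < ⊤}, K (ENNReal.ofReal (τ₁ ω).toReal) ∂μ := by
    rw [← lintegral_indicator hfin]
    refine lintegral_congr fun ω => ?_
    by_cases h : τ₁ ω < ⊤
    · rw [Set.indicator_of_mem (s := {ω | τ₁ ω < ⊤}) h, ENNReal.ofReal_toReal h.ne]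
    · rw [Set.indicator_of_notMem (s := {ω | τ₁ ω < ⊤}) h, not_lt_top_iff.1 h]
      simp [hK]
  have e3 := map_toReal_restrict_of_survival h₁ hF hf
  have hKr : Measurable fun x : ℝ => K (ENNReal.ofReal x) := hKm.comp ENNReal.measurable_ofReal
  rw [e1, e2, ← lintegral_map (f := fun x => K (ENNReal.ofReal x)) hKr h₁.ennreal_toReal, e3,
    lintegral_withDensity_eq_lintegral_mul _ hfm hKr, restrict_Ioi_eq_restrict_Ici]
  refine setLIntegral_congr_fun measurableSet_Ici fun x hx => ?_
  simp only [Pi.mul_apply, hK]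
  rw [measure_ofReal_lt hG hGc hx]

end Survival

/-! ### Regularity of Λ and the density of the serving distance. -/

namespace Network

variable (net : Network)

/-- The density of `Λ^s_{k,PHP}`. -/
def lamDensity (k : Tier) (s : LinkState) (x : ℝ) : ℝ :=
  2 * Real.pi * net.density k * (x * net.stateProbExt s x)

lemma lamDensity_nonneg (k : Tier) (s : LinkState) {x : ℝ} (hx : 0 ≤ x) :
    0 ≤ net.lamDensity k s x :=
  mul_nonneg (mul_nonneg (by positivity) (net.density_pos k).le)
    (mul_nonneg hx (net.stateProbExt_nonneg s x))

lemma measurable_lamDensity (k : Tier) (s : LinkState) : Measurable (net.lamDensity k s) :=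
  (measurable_id.mul (net.measurable_stateProbExt s)).const_mul _

lemma intervalIntegrable_lamDensity (k : Tier) (s : LinkState) (a b : ℝ) :
    IntervalIntegrable (net.lamDensity k s) volume a b := by
  have hc : IntervalIntegrable (fun x => 2 * Real.pi * net.density k * x) volume a b :=
    (continuous_const.mul continuous_id).intervalIntegrable a b
  refine hc.mono_fun (net.measurable_lamDensity k s).aestronglyMeasurable (ae_of_all _ fun x => ?_)
  simp only [lamDensity, norm_mul]
  rw [← mul_assoc, Real.norm_of_nonneg (net.stateProbExt_nonneg s x)]
  exact mul_le_of_le_one_right (by positivity) (net.stateProbExt_le_one s x)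

lemma Lam_eq_integral (k : Tier) (s : LinkState) {r : ℝ} (hr : 0 ≤ r) :
    net.Lam k s r = ∫ x in (0 : ℝ)..r, net.lamDensity k s x := by
  rw [Lam, ← intervalIntegral.integral_const_mul]
  refine intervalIntegral.integral_congr fun x hx => ?_
  rw [Set.uIcc_of_le hr] at hx
  simp only [lamDensity, net.stateProbExt_of_nonneg s hx.1]

lemma Lam_zero (k : Tier) (s : LinkState) : net.Lam k s 0 = 0 := by simp [Lam]

lemma continuousOn_Lam (k : Tier) (s : LinkState) : ContinuousOn (net.Lam k s) (Set.Ici 0) :=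
  (intervalIntegral.continuous_primitive (net.intervalIntegrable_lamDensity k s) 0).continuousOn.congr
    fun _ hr => net.Lam_eq_integral k s hr

lemma hasDerivAt_Lam (k : Tier) (s : LinkState) {x : ℝ} (hx : 0 < x)
    (hc : ContinuousAt (net.stateProbExt s) x) :
    HasDerivAt (net.Lam k s) (net.lamDensity k s x) x := by
  have h := intervalIntegral.integral_hasDerivAt_right (net.intervalIntegrable_lamDensity k s 0 x)
    (net.measurable_lamDensity k s).stronglyMeasurable.stronglyMeasurableAtFilter
    (continuousAt_const.mul (continuousAt_id.mul hc))
  refine h.congr_of_eventuallyEq ?_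
  filter_upwards [Ioi_mem_nhds hx] with r hr
  exact net.Lam_eq_integral k s (le_of_lt hr)

lemma ae_hasDerivAt_Lam (k : Tier) (s : LinkState) :
    ∀ᵐ x ∂(volume.restrict (Set.Ioi (0 : ℝ))), HasDerivAt (net.Lam k s) (net.lamDensity k s x) x := by
  filter_upwards [ae_restrict_mem measurableSet_Ioi,
    ae_restrict_of_ae ((net.countable_not_continuousAt_stateProbExt s).ae_notMem volume)]
    with x hx hc
  exact net.hasDerivAt_Lam k s hx (not_not.1 hc)

/-- The antiderivative is -exp(-Λ), differentiable off a countable set, which suffices for the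
fundamental theorem. The `max x 0` only makes the integrand measurable on the whole line. -/
lemma lintegral_lamDensity_mul_exp (k : Tier) (s : LinkState) {a b : ℝ} (ha : 0 ≤ a) (hab : a ≤ b) :
    ∫⁻ x in Set.Ico a b, ENNReal.ofReal (net.lamDensity k s x * Real.exp (-net.Lam k s (max x 0))) =
      ENNReal.ofReal (Real.exp (-net.Lam k s a)) - ENNReal.ofReal (Real.exp (-net.Lam k s b)) := by
  set φ : ℝ → ℝ := fun x => net.lamDensity k s x * Real.exp (-net.Lam k s (max x 0)) with hφ
  have hcL : Continuous fun x : ℝ => Real.exp (-net.Lam k s (max x 0)) :=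
    Real.continuous_exp.comp ((net.continuousOn_Lam k s).comp_continuous
      (continuous_id.max continuous_const) fun x => Set.mem_Ici.2 (le_max_right _ _)).neg
  have hint : IntervalIntegrable φ volume a b :=
    (net.intervalIntegrable_lamDensity k s a b).mul_continuousOn hcL.continuousOn
  have hFTC : ∫ x in a..b, φ x =
      -Real.exp (-net.Lam k s b) - -Real.exp (-net.Lam k s a) := by
    refine integral_eq_of_hasDerivAt_off_countable_of_le (fun x => -Real.exp (-net.Lam k s x)) φ hab
      (net.countable_not_continuousAt_stateProbExt s) ?_ (fun x hx => ?_) hint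
    · exact (Real.continuous_exp.comp_continuousOn ((net.continuousOn_Lam k s).mono
        fun x hx => Set.mem_Ici.2 (ha.trans hx.1)).neg).neg
    · have hx0 : 0 < x := ha.trans_lt hx.1.1
      have := (net.hasDerivAt_Lam k s hx0 (not_not.1 hx.2)).neg.exp.neg
      convert! this using 1
      simp only [hφ, max_eq_left hx0.le, Pi.neg_apply]
      ring
  rw [intervalIntegral.integral_of_le hab, integral_Ioc_eq_integral_Ioo,
    ← integral_Ico_eq_integral_Ioo] at hFTC
  have hint' : IntegrableOn φ (Set.Ico a b) :=
    (integrableOn_Ico_iff_integrableOn_Ioo).2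
      ((integrableOn_Ioc_iff_integrableOn_Ioo).1 ((intervalIntegrable_iff_integrableOn_Ioc_of_le hab).1 hint))
  rw [← ofReal_integral_eq_lintegral_ofReal hint', hFTC, ← ENNReal.ofReal_sub _ (Real.exp_pos _).le]
  · congr 1
    ring
  · filter_upwards [ae_restrict_mem measurableSet_Ico] with x hx
    exact mul_nonneg (net.lamDensity_nonneg k s (ha.trans hx.1)) (Real.exp_pos _).le

end Network

/-- Strict bounds may be lost in an infinite infimum; here it is either attained below `c` or at
least `c`. -/
lemma lt_iInf_of_finite {ι : Type*} {v : ι → ENNReal} {a c : ENNReal} (hac : a < c)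
    (hfin : {p | v p < c}.Finite) (hv : ∀ p, a < v p) : a < ⨅ p, v p := by
  rcases Set.eq_empty_or_nonempty {p | v p < c} with he | hne
  · refine hac.trans_le (le_iInf fun p => not_lt.1 fun hp => ?_)
    exact Set.notMem_empty p (he ▸ hp)
  · obtain ⟨q, hq, hmin⟩ := Set.exists_min_image _ v hfin hne
    refine (hv q).trans_le (le_iInf fun p => ?_)
    by_cases hp : v p < c
    · exact hmin p hp
    · exact (le_of_lt hq).trans (not_lt.1 hp)

/-! ### Equivalent distances and the association event. -/

namespace Network

variable (net : Network)

/-- The ratio of the powers times gains of two tiers. -/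
def gainRatio (k j : Tier) : ℝ := net.P j / net.P k * (net.M j / net.M k)

lemma gainRatio_pos (k j : Tier) : 0 < net.gainRatio k j :=
  mul_pos (div_pos (net.P_pos j) (net.P_pos k)) (div_pos (net.M_pos j) (net.M_pos k))

lemma gainRatio_self (k : Tier) : net.gainRatio k k = 1 := by
  rw [gainRatio, div_self (net.P_pos k).ne', div_self (net.M_pos k).ne', mul_one]

/-- The distance at which a BS of tier `k` in state `s` provides the same average received power
as a BS of tier `j` in state `s'` at distance `d`. -/
def equivDist (k : Tier) (s : LinkState) (j : Tier) (s' : LinkState) (d : ℝ) : ℝ :=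
  (d ^ net.α s' / net.gainRatio k j) ^ (net.α s)⁻¹

lemma equivDist_self (k : Tier) (s : LinkState) {d : ℝ} (hd : 0 ≤ d) :
    net.equivDist k s k s d = d := by
  rw [equivDist, gainRatio_self, div_one, Real.rpow_rpow_inv hd (net.α_pos s).ne']

lemma equivDist_nonneg (k : Tier) (s : LinkState) (j : Tier) (s' : LinkState) {d : ℝ}
    (hd : 0 ≤ d) : 0 ≤ net.equivDist k s j s' d :=
  Real.rpow_nonneg (div_nonneg (Real.rpow_nonneg hd _) (net.gainRatio_pos k j).le) _

lemma exclusionRadius_nonneg (k : Tier) (s : LinkState) (j : Tier) (s' : LinkState) {x : ℝ}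
    (hx : 0 ≤ x) : 0 ≤ net.exclusionRadius k s j s' x :=
  mul_nonneg (Real.rpow_nonneg (net.gainRatio_pos k j).le _) (Real.rpow_nonneg hx _)

lemma exclusionRadius_self (k : Tier) (s : LinkState) (x : ℝ) :
    net.exclusionRadius k s k s x = x := by
  have := net.gainRatio_self k
  rw [gainRatio] at this
  rw [exclusionRadius, this, Real.one_rpow, one_mul, div_self (net.α_pos s).ne', Real.rpow_one]

lemma exclusionRadius_zero (k : Tier) (s : LinkState) (j : Tier) (s' : LinkState) :
    net.exclusionRadius k s j s' 0 = 0 := by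
  rw [exclusionRadius, Real.zero_rpow (div_pos (net.α_pos s) (net.α_pos s')).ne', mul_zero]

lemma continuous_exclusionRadius (k : Tier) (s : LinkState) (j : Tier) (s' : LinkState) :
    Continuous (net.exclusionRadius k s j s') :=
  continuous_const.mul (continuous_id.rpow_const fun _ =>
    Or.inr (div_pos (net.α_pos s) (net.α_pos s')).le)

lemma exclusionRadius_le_iff (k : Tier) (s : LinkState) (j : Tier) (s' : LinkState) {x d : ℝ}
    (hx : 0 ≤ x) (hd : 0 ≤ d) :
    net.exclusionRadius k s j s' x ≤ d ↔ x ≤ net.equivDist k s j s' d := by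
  have hc := net.gainRatio_pos k j
  have h1 : net.exclusionRadius k s j s' x = (net.gainRatio k j * x ^ net.α s) ^ (net.α s')⁻¹ := by
    rw [Real.mul_rpow hc.le (Real.rpow_nonneg hx _), ← Real.rpow_mul hx, ← div_eq_mul_inv,
      exclusionRadius, one_div, gainRatio]
  rw [h1, equivDist, Real.rpow_inv_le_iff_of_pos (by positivity) hd (net.α_pos s'),
    Real.le_rpow_inv_iff_of_pos hx (by positivity) (net.α_pos s), le_div_iff₀ hc, mul_comm]

/-- The user gain cancels. Positive distances matter: a negative power of 0 is 0 by convention. -/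
lemma avgPower_lt_iff (k : Tier) (s : LinkState) (j : Tier) (s' : LinkState) {r d : ℝ}
    (hr : 0 < r) (hd : 0 < d) :
    net.avgPower j s' d < net.avgPower k s r ↔ r < net.equivDist k s j s' d := by
  have hc := net.gainRatio_pos k j
  have hPk := net.P_pos k
  have hMk := net.M_pos k
  have hU := net.MUE_pos
  have hr' : 0 < r ^ net.α s := Real.rpow_pos_of_pos hr _
  have hd' : 0 < d ^ net.α s' := Real.rpow_pos_of_pos hd _
  rw [equivDist, Real.lt_rpow_inv_iff_of_pos hr.le (by positivity) (net.α_pos s), lt_div_iff₀ hc,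
    avgPower, avgPower, Real.rpow_neg hd.le, Real.rpow_neg hr.le, ← div_eq_mul_inv,
    ← div_eq_mul_inv, div_lt_div_iff₀ hd' hr', gainRatio]
  have e : r ^ net.α s * (net.P j / net.P k * (net.M j / net.M k)) =
      (net.P j * (net.M j * net.MUE) * r ^ net.α s) / (net.P k * (net.M k * net.MUE)) := by
    field_simp
  rw [e, div_lt_iff₀ (by positivity), mul_comm (d ^ net.α s')]

/-- The mean number of BSs, other than those of tier `k` in state `s`, that provide a larger
average received power than a BS of tier `k` in state `s` at distance `x`. -/
def interfererMean (k : Tier) (s : LinkState) (x : ℝ) : ℝ :=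
  ∑ j, ∑ s', if j = k ∧ s' = s then 0 else net.Lam j s' (net.exclusionRadius k s j s' x)

/-- Separating a from b in the exponent is what makes the joint survival function factor. -/
lemma sum_Lam_eq (k : Tier) (s : LinkState) (a b : ℝ) :
    ∑ j, ∑ s', net.Lam j s' (if j = k ∧ s' = s then a else net.exclusionRadius k s j s' b) =
      net.Lam k s a + net.interfererMean k s b := by
  simp only [interfererMean, sum_tier, sum_linkState]
  cases k <;> cases s <;> simp <;> ring

lemma sum_Lam_exclusionRadius (k : Tier) (s : LinkState) (x : ℝ) :
    ∑ j, ∑ s', net.Lam j s' (net.exclusionRadius k s j s' x) =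
      net.Lam k s x + net.interfererMean k s x := by
  rw [← net.sum_Lam_eq k s x x]
  refine Finset.sum_congr rfl fun j _ => Finset.sum_congr rfl fun s' _ => ?_
  split_ifs with h
  · rw [h.1, h.2, exclusionRadius_self]
  · rfl

lemma interfererMean_zero (k : Tier) (s : LinkState) : net.interfererMean k s 0 = 0 := by
  simp [interfererMean, exclusionRadius_zero, Lam_zero]

lemma continuousOn_interfererMean (k : Tier) (s : LinkState) :
    ContinuousOn (net.interfererMean k s) (Set.Ici 0) := by
  refine continuousOn_finsetSum _ fun j _ => continuousOn_finsetSum _ fun s' _ => ?_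
  split_ifs
  · exact continuousOn_const
  · exact (net.continuousOn_Lam j s').comp (net.continuous_exclusionRadius k s j s').continuousOn
      fun x hx => net.exclusionRadius_nonneg k s j s' hx

section Model

variable {net} {Ω : Type*} {X : Tier → ℕ → Ω → Plane} {S : Tier → ℕ → Ω → LinkState}

/-- The distance to the nearest BS of tier `k` in state `s`. -/
def servingDist (X : Tier → ℕ → Ω → Plane) (S : Tier → ℕ → Ω → LinkState) (k : Tier)
    (s : LinkState) (ω : Ω) : ENNReal :=
  ⨅ i, if S k i ω = s then ENNReal.ofReal ‖X k i ω‖ else ⊤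

variable (net) in
/-- The least equivalent distance of the BSs that are not of tier `k` in state `s`. -/
def competingDist (X : Tier → ℕ → Ω → Plane) (S : Tier → ℕ → Ω → LinkState) (k : Tier)
    (s : LinkState) (ω : Ω) : ENNReal :=
  ⨅ p : Tier × ℕ, if p.1 = k ∧ S p.1 p.2 ω = s then ⊤ else
    ENNReal.ofReal (net.equivDist k s p.1 (S p.1 p.2 ω) ‖X p.1 p.2 ω‖)

lemma le_servingDist_and_le_competingDist_iff (k : Tier) (s : LinkState) {a b : ℝ}
    (hb : 0 ≤ b) (ω : Ω) :
    (ENNReal.ofReal a ≤ servingDist X S k s ω ∧ ENNReal.ofReal b ≤ net.competingDist X S k s ω) ↔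
      ∀ j i, (if j = k ∧ S j i ω = s then a else net.exclusionRadius k s j (S j i ω) b) ≤
        ‖X j i ω‖ := by
  rw [servingDist, competingDist, le_iInf_iff, le_iInf_iff]
  constructor
  · rintro ⟨h1, h2⟩ j i
    split_ifs with h
    · obtain ⟨rfl, h⟩ := h
      have := h1 i
      rwa [if_pos h, ENNReal.ofReal_le_ofReal_iff (norm_nonneg _)] at this
    · have := h2 (j, i)
      rw [if_neg h, ENNReal.ofReal_le_ofReal_iff
        (net.equivDist_nonneg _ _ _ _ (norm_nonneg _))] at this
      exact (net.exclusionRadius_le_iff k s j _ hb (norm_nonneg _)).2 this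
  · refine fun h => ⟨fun i => ?_, fun p => ?_⟩
    · split_ifs with hs
      · have := h k i
        rw [if_pos ⟨rfl, hs⟩] at this
        exact ENNReal.ofReal_le_ofReal this
      · exact le_top
    · split_ifs with hs
      · exact le_top
      · have := h p.1 p.2
        rw [if_neg hs, net.exclusionRadius_le_iff k s p.1 _ hb (norm_nonneg _)] at this
        exact ENNReal.ofReal_le_ofReal this

lemma mem_associated_iff (k : Tier) (s : LinkState) {ω : Ω} (hpos : ∀ j i, 0 < ‖X j i ω‖)
    (hfin : ∀ j (r : ℝ), {i | ‖X j i ω‖ < r}.Finite)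
    (hties : ∀ i i', i ≠ i' → ‖X k i ω‖ ≠ ‖X k i' ω‖) :
    ω ∈ net.associated X S k s ↔ servingDist X S k s ω < net.competingDist X S k s ω := by
  constructor
  · rintro ⟨i, hi, hlt⟩
    have h1 : servingDist X S k s ω ≤ ENNReal.ofReal ‖X k i ω‖ :=
      (iInf_le _ i).trans (by rw [if_pos hi])
    refine h1.trans_lt (lt_iInf_of_finite (c := ENNReal.ofReal (‖X k i ω‖ + 1)) ?_ ?_ ?_)
    · rw [ENNReal.ofReal_lt_ofReal_iff_of_nonneg (norm_nonneg _)]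
      linarith
    · have hx : 0 ≤ ‖X k i ω‖ + 1 := by positivity
      -- The sum over states dominates each exclusion radius, so local finiteness applies whatever
      -- the state of the link.
      let m : Tier → ℝ := fun j => ∑ s', net.exclusionRadius k s j s' (‖X k i ω‖ + 1)
      have hf : (⋃ j, (fun i' : ℕ => (j, i')) '' {i' | ‖X j i' ω‖ < m j}).Finite :=
        Set.finite_iUnion fun j => (hfin j (m j)).image _
      refine hf.subset fun p hp => ?_
      simp only [Set.mem_ofPred_eq] at hp
      split_ifs at hp with h
      · exact absurd hp not_top_lt
      · have h2 : net.equivDist k s p.1 (S p.1 p.2 ω) ‖X p.1 p.2 ω‖ < ‖X k i ω‖ + 1 :=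
          (ENNReal.ofReal_lt_ofReal_iff_of_nonneg
            (net.equivDist_nonneg _ _ _ _ (norm_nonneg _))).1 hp
        rw [← not_le, ← net.exclusionRadius_le_iff k s p.1 _ hx (norm_nonneg _), not_le] at h2
        refine Set.mem_iUnion.2 ⟨p.1, p.2, h2.trans_le ?_, rfl⟩
        exact Finset.single_le_sum
          (f := fun s' => net.exclusionRadius k s p.1 s' (‖X k i ω‖ + 1))
          (fun s' _ => net.exclusionRadius_nonneg k s p.1 s' hx) (Finset.mem_univ _)
    · intro p
      split_ifs with h
      · exact ENNReal.ofReal_lt_top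
      · rw [ENNReal.ofReal_lt_ofReal_iff_of_nonneg (norm_nonneg _)]
        refine (net.avgPower_lt_iff k s p.1 _ (hpos k i) (hpos _ _)).1 (hlt p.1 p.2 ?_)
        rintro ⟨⟩
        exact h ⟨rfl, hi⟩
  · intro hlt
    have hτ : servingDist X S k s ω ≠ ⊤ := (hlt.trans_le le_top).ne
    -- The infimum is attained: otherwise local finiteness would make it strictly smaller than
    -- itself.
    obtain ⟨i, hi⟩ : ∃ i, (if S k i ω = s then ENNReal.ofReal ‖X k i ω‖ else ⊤) ≤
        servingDist X S k s ω := by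
      by_contra! hcon
      refine lt_irrefl _ (lt_iInf_of_finite
        (c := ENNReal.ofReal ((servingDist X S k s ω).toReal + 1)) ?_ ?_ hcon)
      · exact (ENNReal.lt_ofReal_iff_toReal_lt hτ).2 (lt_add_one _)
      · refine (hfin k ((servingDist X S k s ω).toReal + 1)).subset fun i hi => ?_
        simp only [Set.mem_ofPred_eq] at hi ⊢
        split_ifs at hi with h
        · exact (ENNReal.ofReal_lt_ofReal_iff_of_nonneg (norm_nonneg _)).1 hi
        · exact absurd hi not_top_lt
    split_ifs at hi with hs
    swap
    · exact absurd (top_le_iff.1 hi) hτ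
    refine ⟨i, hs, fun j i' hne => ?_⟩
    rw [net.avgPower_lt_iff k s j _ (hpos k i) (hpos j i')]
    -- Rivals of the same class are invisible to τ₂; strictness against them comes from the absence
    -- of ties.
    by_cases hc : j = k ∧ S j i' ω = s
    · obtain ⟨rfl, hs'⟩ := hc
      have hne' : i ≠ i' := fun h => hne (by rw [h])
      rw [hs', net.equivDist_self j s (norm_nonneg _)]
      refine lt_of_le_of_ne ?_ (hties i i' hne')
      have := hi.trans (iInf_le _ i')
      rwa [if_pos hs', ENNReal.ofReal_le_ofReal_iff (norm_nonneg _)] at this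
    · have := (hi.trans_lt hlt).trans_le (iInf_le _ (j, i'))
      rwa [if_neg hc, ENNReal.ofReal_lt_ofReal_iff_of_nonneg (norm_nonneg _)] at this

variable [MeasurableSpace Ω] {μ : Measure Ω}

/-- The state space is countable and discrete, so measurability in the location is enough. -/
lemma IsModel.measurable_comp (h : net.IsModel X S μ) {β : Type*} [MeasurableSpace β]
    {f : LinkState → Plane → β} (hf : ∀ s, Measurable (f s)) (j : Tier) (i : ℕ) :
    Measurable fun ω => f (S j i ω) (X j i ω) := by
  have : Measurable fun p : LinkState × Plane => f p.1 p.2 := measurable_from_prod_countable_right hf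
  exact this.comp ((h.measurable_state j i).prodMk (h.measurable_location j i))

lemma IsModel.measurable_servingDist (h : net.IsModel X S μ) (k : Tier) (s : LinkState) :
    Measurable (servingDist X S k s) := by
  refine Measurable.iInf fun i => h.measurable_comp
    (f := fun s' x => if s' = s then ENNReal.ofReal ‖x‖ else ⊤) (fun s' => ?_) k i
  split_ifs
  · exact measurable_norm.ennreal_ofReal
  · exact measurable_const

lemma IsModel.measurable_competingDist (h : net.IsModel X S μ) (k : Tier) (s : LinkState) :
    Measurable (net.competingDist X S k s) := by
  refine Measurable.iInf fun p => h.measurable_comp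
    (f := fun s' x => if p.1 = k ∧ s' = s then ⊤ else
      ENNReal.ofReal (net.equivDist k s p.1 s' ‖x‖)) (fun s' => ?_) p.1 p.2
  split_ifs
  · exact measurable_const
  · exact (((measurable_norm.pow_const _).div_const _).pow_const _).ennreal_ofReal

lemma IsModel.measurableSet_associated (h : net.IsModel X S μ) (k : Tier) (s : LinkState) :
    MeasurableSet (net.associated X S k s) := by
  have hp : ∀ s' j i, Measurable fun ω => net.avgPower j s' ‖X j i ω‖ := fun s' j i =>
    ((h.measurable_location j i).norm.pow_const _).const_mul _
  have hp' : ∀ j i, Measurable fun ω => net.avgPower j (S j i ω) ‖X j i ω‖ := fun j i =>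
    h.measurable_comp (f := fun s' x => net.avgPower j s' ‖x‖)
      (fun s' => (measurable_norm.pow_const _).const_mul _) j i
  have heq : net.associated X S k s = ⋃ i, (S k i ⁻¹' {s} ∩
      ⋂ (j : Tier) (i' : ℕ) (_ : (j, i') ≠ (k, i)),
        {ω | net.avgPower j (S j i' ω) ‖X j i' ω‖ < net.avgPower k s ‖X k i ω‖}) := by
    ext ω
    simp only [associated, Set.mem_ofPred_eq, Set.mem_iUnion, Set.mem_inter_iff, Set.mem_preimage,
      Set.mem_singleton_iff, Set.mem_iInter]
  rw [heq]
  exact MeasurableSet.iUnion fun i =>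
    (h.measurable_state k i MeasurableSpace.measurableSet_top).inter <|
      MeasurableSet.iInter fun j => MeasurableSet.iInter fun i' => MeasurableSet.iInter fun _ =>
        measurableSet_lt (hp' j i') (hp s k i)

lemma IsModel.associated_ae_eq (h : net.IsModel X S μ) (k : Tier) (s : LinkState) :
    net.associated X S k s =ᵐ[μ] {ω | servingDist X S k s ω < net.competingDist X S k s ω} := by
  have h1 : ∀ᵐ ω ∂μ, ∀ j i, 0 < ‖X j i ω‖ :=
    ae_all_iff.2 fun j => ae_norm_pos_of_isPoissonProcess (h.poisson j)
  have h2 : ∀ᵐ ω ∂μ, ∀ j (r : ℝ), {i | ‖X j i ω‖ < r}.Finite :=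
    ae_all_iff.2 fun j => ae_finite_of_isPoissonProcess (h.poisson j)
  filter_upwards [h1, h2, ae_norm_ne_of_isPoissonProcess (h.poisson k) (net.density_pos k).le]
    with ω hpos hfin hties
  exact propext (mem_associated_iff k s hpos hfin hties)

variable [IsProbabilityMeasure μ]

theorem IsModel.measure_associated (h : net.IsModel X S μ) (k : Tier) (s : LinkState) :
    μ (net.associated X S k s) = ∫⁻ x in Set.Ioi (0 : ℝ), ENNReal.ofReal (net.lamDensity k s x *
      Real.exp (-∑ j, ∑ s', net.Lam j s' (net.exclusionRadius k s j s' x))) := by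
  rw [measure_congr (h.associated_ae_eq k s)]
  have hcL : Continuous fun x : ℝ => Real.exp (-net.Lam k s (max x 0)) :=
    Real.continuous_exp.comp ((net.continuousOn_Lam k s).comp_continuous
      (continuous_id.max continuous_const) fun x => Set.mem_Ici.2 (le_max_right _ _)).neg
  rw [measure_lt_of_survival (F := fun x => Real.exp (-net.Lam k s x))
    (G := fun x => Real.exp (-net.interfererMean k s x))
    (f := fun x => ENNReal.ofReal (net.lamDensity k s x * Real.exp (-net.Lam k s (max x 0))))
    (h.measurable_servingDist k s) (h.measurable_competingDist k s) (fun a b ha hb => ?_)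
    (by simp [Lam_zero]) (by simp [interfererMean_zero])
    (Real.continuous_exp.comp_continuousOn (net.continuousOn_interfererMean k s).neg)
    ((net.measurable_lamDensity k s).mul hcL.measurable).ennreal_ofReal
    (fun a b ha hab => net.lintegral_lamDensity_mul_exp k s ha hab)]
  · refine setLIntegral_congr_fun measurableSet_Ioi fun x hx => ?_
    have hx : 0 < x := hx
    rw [max_eq_left hx.le, ← ENNReal.ofReal_mul (mul_nonneg (net.lamDensity_nonneg k s hx.le)
      (Real.exp_pos _).le), mul_assoc, ← Real.exp_add, sum_Lam_exclusionRadius, neg_add]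
  · simp_rw [le_servingDist_and_le_competingDist_iff k s hb]
    rw [h.measure_forall_radii
      (ρ := fun j s' => if j = k ∧ s' = s then a else net.exclusionRadius k s j s' b),
      sum_Lam_eq, ← ENNReal.ofReal_mul (Real.exp_pos _).le, ← Real.exp_add, neg_add]
    intro j s'
    split_ifs
    · exact ha
    · exact net.exclusionRadius_nonneg k s j s' hb

end Model

end Network

end HCN
end

theorem lemma2 (net : HCN.Network) {Ω : Type*} [MeasurableSpace Ω] (μ : Measure Ω)
    [IsProbabilityMeasure μ] (X : HCN.Tier → ℕ → Ω → HCN.Plane)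
    (S : HCN.Tier → ℕ → Ω → HCN.LinkState) (hmodel : net.IsModel X S μ)
    (k : HCN.Tier) (s : HCN.LinkState) :
    MeasurableSet (net.associated X S k s) ∧
    (∀ᵐ x ∂(volume.restrict (Set.Ioi (0 : ℝ))), DifferentiableAt ℝ (net.Lam k s) x) ∧
    IntegrableOn (fun x : ℝ => deriv (net.Lam k s) x *
      Real.exp (-∑ j : HCN.Tier, ∑ s' : HCN.LinkState,
        net.Lam j s' (net.exclusionRadius k s j s' x))) (Set.Ioi 0) ∧
    μ.real (net.associated X S k s) =
      ∫ x in Set.Ioi (0 : ℝ), deriv (net.Lam k s) x *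
        Real.exp (-∑ j : HCN.Tier, ∑ s' : HCN.LinkState,
          net.Lam j s' (net.exclusionRadius k s j s' x)) := by
  have hderiv := net.ae_hasDerivAt_Lam k s
  set E : ℝ → ℝ := fun x => Real.exp (-∑ j : HCN.Tier, ∑ s' : HCN.LinkState,
    net.Lam j s' (net.exclusionRadius k s j s' x)) with hE
  have hae : (fun x => deriv (net.Lam k s) x * E x) =ᵐ[volume.restrict (Set.Ioi (0 : ℝ))]
      fun x => net.lamDensity k s x * E x := by
    filter_upwards [hderiv] with x hx
    rw [hx.deriv]
  have hEc : ContinuousOn E (Set.Ici 0) :=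
    Real.continuous_exp.comp_continuousOn (continuousOn_finsetSum _ fun j _ =>
      continuousOn_finsetSum _ fun s' _ => (net.continuousOn_Lam j s').comp
        (net.continuous_exclusionRadius k s j s').continuousOn
        fun x hx => net.exclusionRadius_nonneg k s j s' hx).neg
  have hmeas : AEStronglyMeasurable (fun x => net.lamDensity k s x * E x)
      (volume.restrict (Set.Ioi (0 : ℝ))) :=
    (net.measurable_lamDensity k s).aestronglyMeasurable.mul
      ((hEc.mono Set.Ioi_subset_Ici_self).aestronglyMeasurable measurableSet_Ioi)
  have hnonneg : 0 ≤ᵐ[volume.restrict (Set.Ioi (0 : ℝ))] fun x => net.lamDensity k s x * E x := by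
    filter_upwards [ae_restrict_mem measurableSet_Ioi] with x hx
    exact mul_nonneg (net.lamDensity_nonneg k s (le_of_lt hx)) (Real.exp_pos _).le
  -- Identifying the lower integral with a probability also yields integrability.
  have hprob := hmodel.measure_associated k s
  have hint : Integrable (fun x => net.lamDensity k s x * E x)
      (volume.restrict (Set.Ioi (0 : ℝ))) := by
    refine ⟨hmeas, ?_⟩
    rw [hasFiniteIntegral_iff_ofReal hnonneg, ← hprob]
    exact measure_lt_top _ _
  refine ⟨hmodel.measurableSet_associated k s, hderiv.mono fun x hx => hx.differentiableAt,
    hint.congr hae.symm, ?_⟩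
  rw [integral_congr_ae hae, integral_eq_lintegral_of_nonneg_ae hnonneg hmeas, ← hprob,
    measureReal_def]
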